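/- A catalytic RAM machine is a fixed finite program with a finite number of work registers (its workspace is the total number of bits held in them), with constant-time random access to the individual bits of a catalytic tape that initially holds an arbitrary string $\tau$, and with unit-cost arithmetic ($+$, truncated $-$, $\times$, integer division, remainder) and comparisons on the registers. A randomized machine may also toss fair coins. A directed graph on the vertex set $\{0,\dots,n-1\}$ is given by oracle access: the machine can query $n$, the in-degree and the out-degree of a vertex, and the $i$-th in-neighbour or out-neighbour of a vertex (the neighbours being listed in an arbitrary order), and it can also read $s$ and $t$. Theorem. There is a randomized catalytic RAM machine that, given a simple directed graph $G$ (no loops, no parallel edges) with $n$ vertices and $m\ge n$ edges together with vertices $s,t$, decides whether there is a directed path from $s$ to $t$, in the following sense. For every such $G,s,t$, every listing of the neighbours and every initial content $\tau$ of the catalytic tape: 1. for every outcome of the coin tosses, the machine halts with an answer yes or no, and with the catalytic tape restored to $\tau$; 2. if there is no path from $s$ to $t$, the answer is always no; 3. if there is a path from $s$ to $t$, the answer is yes with probability at least $1/2$. Moreover, for every outcome of the coin tosses, the machine uses $O(\log n)$ bits of workspace and a catalytic tape of $\tilde O(n)$ bits, and halts within $\tilde O(nm)$ steps, where $\tilde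 O(\cdot)$ hides factors polylogarithmic in $n$. -/

import Mathlib

open MeasureTheory

noncomputable section

namespace CatRAM

/-- Number of edges of a directed graph on `Fin n`. -/
def numEdges {n : ℕ} (G : Digraph (Fin n)) : ℕ :=
  Set.ncard {e : Fin n × Fin n | G.Adj e.1 e.2}

/-- A presentation of `G` for oracle access: every vertex has a list of its in-neighbours and a
list of its out-neighbours, without repetitions and in an arbitrary order. -/
structure GraphOracle {n : ℕ} (G : Digraph (Fin n)) where
  inList : Fin n → List (Fin n)
  outList : Fin n → List (Fin n)
  inList_nodup : ∀ v, (inList v).Nodup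
  outList_nodup : ∀ v, (outList v).Nodup
  mem_inList : ∀ u v, u ∈ inList v ↔ G.Adj u v
  mem_outList : ∀ u v, v ∈ outList u ↔ G.Adj u v

/-- The list attached to the number `v`, if `v` is a vertex (and the empty list otherwise). -/
def listAt {n : ℕ} (l : Fin n → List (Fin n)) (v : ℕ) : List (Fin n) :=
  if h : v < n then l ⟨v, h⟩ else []

/-- Answer to a degree query. -/
def degQuery {n : ℕ} (l : Fin n → List (Fin n)) (v : ℕ) : ℕ :=
  (listAt l v).length

/-- Answer to the query for the `i`-th neighbour (counted from `0`): `u + 1` if this neighbour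
is `u`, and `0` (standing for `⊥`) if there is none. -/
def nbrQuery {n : ℕ} (l : Fin n → List (Fin n)) (v i : ℕ) : ℕ :=
  match (listAt l v)[i]? with
  | some u => u.val + 1
  | none => 0

/-- Word operations. Subtraction truncates at `0`; division and remainder are those of `ℕ`. -/
inductive ArithOp
  | add | sub | mul | div | mod

def ArithOp.eval : ArithOp → ℕ → ℕ → ℕ
  | .add, x, y => x + y
  | .sub, x, y => x - y
  | .mul, x, y => x * y
  | .div, x, y => x / y
  | .mod, x, y => x % y

/-- Instructions, over a set `Lbl` of program labels and a set `Reg` of work registers.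
A trailing label is the label of the instruction to be executed next. -/
inductive Instr (Lbl Reg : Type)
  /-- load a constant -/
  | const (dst : Reg) (value : ℕ) (next : Lbl)
  /-- apply a word operation to two registers -/
  | arith (op : ArithOp) (dst a b : Reg) (next : Lbl)
  /-- load the number of vertices -/
  | getN (dst : Reg) (next : Lbl)
  /-- load the source vertex -/
  | getS (dst : Reg) (next : Lbl)
  /-- load the target vertex -/
  | getT (dst : Reg) (next : Lbl)
  /-- oracle query: in-degree of the vertex held by `v` -/
  | inDeg (dst v : Reg) (next : Lbl)
  /-- oracle query: out-degree of the vertex held by `v` -/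
  | outDeg (dst v : Reg) (next : Lbl)
  /-- oracle query: in-neighbour number `i` of the vertex held by `v` -/
  | inNbr (dst v i : Reg) (next : Lbl)
  /-- oracle query: out-neighbour number `i` of the vertex held by `v` -/
  | outNbr (dst v i : Reg) (next : Lbl)
  /-- read the bit of the catalytic tape whose index is held by `idx` -/
  | readCat (dst idx : Reg) (next : Lbl)
  /-- write a bit (`1` iff `src` is nonzero) to the catalytic tape, at the index held by `idx` -/
  | writeCat (idx src : Reg) (next : Lbl)
  /-- toss a fair coin -/
  | flip (dst : Reg) (next : Lbl)
  /-- conditional jump on `a < b` -/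
  | ifLt (a b : Reg) (yes no : Lbl)
  /-- conditional jump on `a = b` -/
  | ifEq (a b : Reg) (yes no : Lbl)
  /-- halt with an answer -/
  | halt (answer : Bool)

/-- A randomized catalytic RAM machine: a finite program over finitely many work registers.
The machine is one fixed finite object, used for inputs of all sizes. -/
structure Machine where
  Lbl : Type
  Reg : Type
  [fintypeLbl : Fintype Lbl]
  [fintypeReg : Fintype Reg]
  [decEqReg : DecidableEq Reg]
  start : Lbl
  code : Lbl → Instr Lbl Reg

attribute [instance] Machine.fintypeLbl Machine.fintypeReg Machine.decEqReg

/-- A configuration of `M` with a catalytic tape of `W` bits. `coinPos` is the number of coins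
tossed so far; the machine has no other access to it, so old coins cannot be read again. -/
@[ext]
structure Config (M : Machine) (W : ℕ) where
  lbl : M.Lbl
  regs : M.Reg → ℕ
  tape : Fin W → Bool
  coinPos : ℕ

/-- The workspace in use in a configuration: the total number of bits of the work registers. -/
def Config.workspace {M : Machine} {W : ℕ} (c : Config M W) : ℕ :=
  ∑ r, Nat.size (c.regs r)

/-- Initial configuration with catalytic tape `τ`; all work registers hold `0`. -/
def Machine.initial (M : Machine) {W : ℕ} (τ : Fin W → Bool) : Config M W where
  lbl := M.start
  regs := fun _ => 0
  tape := τ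
  coinPos := 0

/-- Store `x` in register `d` and continue at label `l`. -/
def Config.store {M : Machine} {W : ℕ} (c : Config M W) (d : M.Reg) (x : ℕ) (l : M.Lbl) :
    Config M W :=
  { c with lbl := l, regs := Function.update c.regs d x }

/-- One step on the graph presented by `O`, with vertices `s`, `t` and coin tosses `coins`.
A configuration at a `halt` instruction is final and does not change any more. An access to the
catalytic tape at an index outside of the tape makes the machine hang forever (without halting). -/
def Machine.step (M : Machine) {n : ℕ} {G : Digraph (Fin n)} (O : GraphOracle G) (s t : Fin n)
    (coins : ℕ → Bool) {W : ℕ} (c : Config M W) : Config M W :=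
  match M.code c.lbl with
  | .const d x l => c.store d x l
  | .arith op d a b l => c.store d (op.eval (c.regs a) (c.regs b)) l
  | .getN d l => c.store d n l
  | .getS d l => c.store d s.val l
  | .getT d l => c.store d t.val l
  | .inDeg d v l => c.store d (degQuery O.inList (c.regs v)) l
  | .outDeg d v l => c.store d (degQuery O.outList (c.regs v)) l
  | .inNbr d v i l => c.store d (nbrQuery O.inList (c.regs v) (c.regs i)) l
  | .outNbr d v i l => c.store d (nbrQuery O.outList (c.regs v) (c.regs i)) l
  | .readCat d i l =>
      if h : c.regs i < W then c.store d (c.tape ⟨c.regs i, h⟩).toNat l else c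
  | .writeCat i a l =>
      if h : c.regs i < W then
        { c with
          lbl := l
          tape := Function.update c.tape ⟨c.regs i, h⟩ (decide (c.regs a ≠ 0)) }
      else c
  | .flip d l => { c.store d (coins c.coinPos).toNat l with coinPos := c.coinPos + 1 }
  | .ifLt a b yes no => { c with lbl := if c.regs a < c.regs b then yes else no }
  | .ifEq a b yes no => { c with lbl := if c.regs a = c.regs b then yes else no }
  | .halt _ => c

/-- The configuration after `k` steps from the initial configuration with catalytic tape `τ`. -/
def Machine.run (M : Machine) {n : ℕ} {G : Digraph (Fin n)} (O : GraphOracle G) (s t : Fin n)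
    (coins : ℕ → Bool) {W : ℕ} (τ : Fin W → Bool) (k : ℕ) : Config M W :=
  (M.step O s t coins)^[k] (M.initial τ)

/-- The answer given by a configuration: `none` if the machine has not halted. -/
def Config.answer {M : Machine} {W : ℕ} (c : Config M W) : Option Bool :=
  match M.code c.lbl with
  | .halt b => some b
  | _ => none

/-- The law of an infinite sequence of independent fair coin tosses. -/
def coinMeasure : Measure (ℕ → Bool) :=
  Measure.infinitePi fun _ : ℕ => (PMF.uniformOfFintype Bool).toMeasure

end CatRAM

end

/-! The tape is cut into `n` blocks of `K = 16 * ℓ` bits, `ℓ = n.size`, which hold arbitrary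
residues `x v` modulo `M = 2 ^ K`. A push at `v` adds to `x v` a function `gain` of the entries of
the in-neighbours of `v`. As there are no loops, the push leaves these contributions unchanged and
can be undone by subtracting them; running the schedule (`n` rounds over all vertices) and then its
reverse restores the tape. An experiment raises `x s` by `d`, runs the schedule, notes the entry of
`t` and undoes everything. The answer is yes iff in some trial the results for `d = 0` and `d = 1`
differ.

Without a path the entry of `s` has no influence on that of `t` (`foldl_addAt_congr`), so the answer
is no. Suppose there is a path. The gain of `y` is the residue modulo `q` of the shifted entry `(y +
a) % M`, for random `a` and `q`. It is at most `q`, so the entries drift little; as long as no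
shifted entry wraps around at `M`, the shifted entries evolve linearly modulo `q`, and the two
results differ modulo `q` by the number `pathCount` of ways to reach `t` (`foldl_addAt_modEq`,
`outcome_ne`). This number is positive and at most `(n + 1) ^ (n * n)`, hence has few prime factors,
and by Chebyshev's bound a random `q < 2 ^ (8 * ℓ)` fails to divide it with probability at least `1
/ (32 * ℓ)` (`card_good_moduli`). A random `a` avoids wrap-around with probability at least `1 / 2`
(`card_good_shifts`). So a trial succeeds with probability at least `1 / (64 * ℓ)`
(`card_badSeeds`), and `64 * ℓ` independent trials all fail with probability at most `1 / e`
(`one_half_le_coinMeasure`).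

The algorithm is written in a loop language whose semantics counts machine steps, verified with the
rule `wp_rep`, and compiled to a machine (`simulation`, `machine_run`). A trial consists essentially
of four sweeps of `n` rounds, each round handling `m` edges at cost `O(K)`; with `4 * K` trials this
gives `O(K ^ 2 * n * m)` steps. -/

namespace CatRAM

/-! ### A small structured language -/

/-- Basic commands over a set `R` of registers. -/
inductive Op (R : Type)
  | const (d : R) (x : ℕ)
  | arith (o : ArithOp) (d a b : R)
  | getN (d : R)
  | getS (d : R)
  | getT (d : R)
  | inDeg (d v : R)
  | inNbr (d v i : R)
  | readCat (d i : R)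
  | writeCat (i a : R)
  | flip (d : R)

/-- Programs: `rep r p` counts the register `r` down to `0`, executing `p` after each decrement. -/
inductive Cmd (R : Type)
  | op (o : Op R)
  | seq (p q : Cmd R)
  | rep (r : R) (p : Cmd R)

/-- States of a program. The tape is extended to all indices, and `clock` counts machine steps. -/
structure State (R : Type) where
  regs : R → ℕ
  tape : ℕ → Bool
  pos : ℕ
  clock : ℕ

/-- Everything the execution of a program depends on, together with the length `W` of the tape
and a strict bound `B` for the contents of the registers. -/
structure Env where
  n : ℕ
  s : ℕ
  t : ℕ
  deg : ℕ → ℕ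
  nbr : ℕ → ℕ → ℕ
  coins : ℕ → Bool
  W : ℕ
  B : ℕ

section Semantics

variable {R : Type} [DecidableEq R]

def Op.writes : Op R → R → Bool
  | .const d _, r => r = d
  | .arith _ d _ _, r => r = d
  | .getN d, r => r = d
  | .getS d, r => r = d
  | .getT d, r => r = d
  | .inDeg d _, r => r = d
  | .inNbr d _ _, r => r = d
  | .readCat d _, r => r = d
  | .writeCat _ _, _ => false
  | .flip d, r => r = d

def Cmd.writes : Cmd R → R → Bool
  | .op o, r => o.writes r
  | .seq p q, r => p.writes r || q.writes r
  | .rep r' p, r => (r = r') || p.writes r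

/-- No loop body writes to the counter of its loop. -/
def Cmd.wf : Cmd R → Bool
  | .op _ => true
  | .seq p q => p.wf && q.wf
  | .rep r p => !p.writes r && p.wf

/-- Store `x` in register `d`, in `k` machine steps. -/
def State.set (σ : State R) (d : R) (x k : ℕ) : State R :=
  { σ with regs := Function.update σ.regs d x, clock := σ.clock + k }

def Op.run (E : Env) : Op R → State R → State R
  | .const d x, σ => σ.set d x 1
  | .arith o d a b, σ => σ.set d (o.eval (σ.regs a) (σ.regs b)) 1
  | .getN d, σ => σ.set d E.n 1
  | .getS d, σ => σ.set d E.s 1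
  | .getT d, σ => σ.set d E.t 1
  | .inDeg d v, σ => σ.set d (E.deg (σ.regs v)) 1
  | .inNbr d v i, σ => σ.set d (E.nbr (σ.regs v) (σ.regs i)) 1
  | .readCat d i, σ => σ.set d (σ.tape (σ.regs i)).toNat 1
  | .writeCat i a, σ =>
      { σ with
        tape := Function.update σ.tape (σ.regs i) (decide (σ.regs a ≠ 0)), clock := σ.clock + 1 }
  | .flip d, σ => { σ.set d (E.coins σ.pos).toNat 1 with pos := σ.pos + 1 }

/-- The command stores a value below the bound and accesses the tape within its limits. -/
def Op.Safe (E : Env) : Op R → State R → Prop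
  | .const _ x, _ => x < E.B
  | .arith o _ a b, σ => o.eval (σ.regs a) (σ.regs b) < E.B
  | .getN _, _ => E.n < E.B
  | .getS _, _ => E.s < E.B
  | .getT _, _ => E.t < E.B
  | .inDeg _ v, σ => E.deg (σ.regs v) < E.B
  | .inNbr _ v i, σ => E.nbr (σ.regs v) (σ.regs i) < E.B
  | .readCat _ i, σ => σ.regs i < E.W
  | .writeCat i _, σ => σ.regs i < E.W
  | .flip _, _ => True

/-- Apply `f (N - 1)`, ..., `f 1`, `f 0` in this order. -/
def iterDown {α : Type*} (f : ℕ → α → α) : ℕ → α → α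
  | 0, x => x
  | i + 1, x => iterDown f i (f i x)

/-- The conjunction of `S i` over all intermediate values of `iterDown`. -/
def allDown {α : Type*} (f : ℕ → α → α) (S : ℕ → α → Prop) : ℕ → α → Prop
  | 0, _ => True
  | i + 1, x => S i x ∧ allDown f S i (f i x)

/-- Each iteration pays two steps for the test and the decrement; the final step is the test that
leaves the loop. Fixing the number of iterations in advance agrees with the machine only when the
body does not write the counter, hence `Cmd.wf`. -/
def Cmd.exec (E : Env) : Cmd R → State R → State R
  | .op o, σ => o.run E σ
  | .seq p q, σ => q.exec E (p.exec E σ)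
  | .rep r p, σ =>
      let τ := iterDown (fun i τ => p.exec E (τ.set r i 2)) (σ.regs r) σ
      { τ with clock := τ.clock + 1 }

/-- Safety is demanded at every intermediate state, because the workspace bound concerns all
configurations. -/
def Cmd.Safe (E : Env) : Cmd R → State R → Prop
  | .op o, σ => o.Safe E σ
  | .seq p q, σ => p.Safe E σ ∧ q.Safe E (p.exec E σ)
  | .rep r p, σ =>
      allDown (fun i τ => p.exec E (τ.set r i 2)) (fun i τ => p.Safe E (τ.set r i 2))
        (σ.regs r) σ

/-! ### Frames and the loop rule -/

/-- The registers not written to by `p` have the same contents in both states. -/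
def Frame (p : Cmd R) (σ τ : State R) : Prop :=
  ∀ r, p.writes r = false → τ.regs r = σ.regs r

theorem Op.frame (E : Env) (o : Op R) (σ : State R) : Frame (.op o) σ (o.run E σ) := by
  intro r h
  cases o <;> simp_all [Cmd.writes, Op.writes, Op.run, State.set]

theorem Cmd.frame (E : Env) (p : Cmd R) (σ : State R) : Frame p σ (p.exec E σ) := by
  induction p generalizing σ with
  | op o => exact o.frame E σ
  | seq p q hp hq =>
    intro r h
    simp only [Cmd.writes, Bool.or_eq_false_iff] at h
    rw [Cmd.exec, hq _ r h.2, hp _ r h.1]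
  | rep r' p hp =>
    intro r h
    simp only [Cmd.writes, Bool.or_eq_false_iff, decide_eq_false_iff_not] at h
    simp only [Cmd.exec]
    generalize σ.regs r' = N
    induction N generalizing σ with
    | zero => rfl
    | succ N ih =>
      rw [iterDown, ih, hp _ r h.2]
      simp [State.set, h.1]

/-- `p` is safe in `σ` and leads to a state with property `Q`. -/
def wp (E : Env) (p : Cmd R) (Q : State R → Prop) (σ : State R) : Prop :=
  p.Safe E σ ∧ Q (p.exec E σ)

theorem wp_op {E : Env} {o : Op R} {Q : State R → Prop} {σ : State R} :
    wp E (.op o) Q σ ↔ o.Safe E σ ∧ Q (o.run E σ) := Iff.rfl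

theorem wp_seq {E : Env} {p q : Cmd R} {Q : State R → Prop} {σ : State R} :
    wp E (.seq p q) Q σ ↔ wp E p (wp E q Q) σ := by
  simp [wp, Cmd.Safe, Cmd.exec, and_assoc]

theorem wp.conseq {E : Env} {p : Cmd R} {P Q : State R → Prop} {σ : State R} (h : wp E p P σ)
    (hPQ : ∀ τ, P τ → Frame p σ τ → Q τ) : wp E p Q σ :=
  ⟨h.1, hPQ _ h.2 (p.frame E σ)⟩

/-- The index of the invariant is the number of iterations left. The clock stays outside the
invariant and is bounded by the sum of the costs `c i`; the frame hypothesis gives the body access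
to all registers that the loop leaves alone. -/
theorem wp_rep {E : Env} {r : R} {p : Cmd R} {σ : State R}
    (I : ℕ → (R → ℕ) → (ℕ → Bool) → ℕ → Prop) (c : ℕ → ℕ)
    (h0 : I (σ.regs r) σ.regs σ.tape σ.pos)
    (hstep : ∀ i τ, i < σ.regs r → I (i + 1) τ.regs τ.tape τ.pos → Frame (.rep r p) σ τ →
      wp E p (fun τ' => I i τ'.regs τ'.tape τ'.pos ∧ τ'.clock ≤ τ.clock + 2 + c i) (τ.set r i 2)) :
    wp E (.rep r p) (fun τ => I 0 τ.regs τ.tape τ.pos ∧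
      τ.clock ≤ σ.clock + ∑ i ∈ Finset.range (σ.regs r), (c i + 2) + 1) σ := by
  have key : ∀ N, N ≤ σ.regs r → ∀ τ : State R, I N τ.regs τ.tape τ.pos → Frame (.rep r p) σ τ →
      let f := fun i τ => p.exec E (State.set τ r i 2)
      allDown f (fun i τ => p.Safe E (τ.set r i 2)) N τ ∧
      I 0 (iterDown f N τ).regs (iterDown f N τ).tape (iterDown f N τ).pos ∧
      (iterDown f N τ).clock ≤ τ.clock + ∑ i ∈ Finset.range N, (c i + 2) := by
    intro N
    induction N with
    | zero => intro _ τ hτ _; exact ⟨trivial, hτ, le_rfl⟩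
    | succ N ih =>
      intro hN τ hτ hfr
      obtain ⟨h1, h2, h3⟩ := hstep N τ (by omega) hτ hfr
      have hfr' : Frame (.rep r p) σ (p.exec E (τ.set r N 2)) := by
        intro r' hr'
        rw [← hfr r' hr']
        simp only [Cmd.writes, Bool.or_eq_false_iff, decide_eq_false_iff_not] at hr'
        rw [p.frame E _ r' hr'.2]
        simp [State.set, hr'.1]
      obtain ⟨k1, k2, k3⟩ := ih (by omega) _ h2 hfr'
      refine ⟨⟨h1, k1⟩, k2, ?_⟩
      rw [Finset.sum_range_succ]
      simp only [iterDown]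
      omega
  obtain ⟨k1, k2, k3⟩ := key _ le_rfl σ h0 fun _ _ => rfl
  exact ⟨k1, k2, Nat.add_le_add_right k3 1⟩

end Semantics

/-! ### Compilation -/

section Compile

variable {R : Type}

/-- The labels of the compiled program. -/
def Cmd.L : Cmd R → Type
  | .op _ => Unit
  | .seq p q => p.L ⊕ q.L
  | .rep _ p => Bool ⊕ p.L

instance Cmd.fintypeL : (p : Cmd R) → Fintype p.L
  | .op _ => inferInstanceAs (Fintype Unit)
  | .seq p q => @instFintypeSum _ _ p.fintypeL q.fintypeL
  | .rep _ p => @instFintypeSum _ _ _ p.fintypeL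

def Cmd.entry : (p : Cmd R) → p.L
  | .op _ => ()
  | .seq p _ => Sum.inl p.entry
  | .rep _ _ => Sum.inl true

def Op.instr {Λ : Type} (next : Λ) : Op R → Instr Λ (Option R)
  | .const d x => .const (some d) x next
  | .arith o d a b => .arith o (some d) (some a) (some b) next
  | .getN d => .getN (some d) next
  | .getS d => .getS (some d) next
  | .getT d => .getT (some d) next
  | .inDeg d v => .inDeg (some d) (some v) next
  | .inNbr d v i => .inNbr (some d) (some v) (some i) next
  | .readCat d i => .readCat (some d) (some i) next
  | .writeCat i a => .writeCat (some i) (some a) next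
  | .flip d => .flip (some d) next

/-- The compiled program, placed at the labels `emb l` and left through the label `exit`. The
register `none` has to hold `1`. -/
def Cmd.code {Λ : Type} : (p : Cmd R) → (p.L → Λ) → Λ → p.L → Instr Λ (Option R)
  | .op o, _, exit, _ => o.instr exit
  | .seq p q, emb, _, Sum.inl l => p.code (emb ∘ Sum.inl) (emb (Sum.inr q.entry)) l
  | .seq _ q, emb, exit, Sum.inr l => q.code (emb ∘ Sum.inr) exit l
  | .rep r _, emb, exit, Sum.inl true => .ifLt (some r) none exit (emb (Sum.inl false))
  | .rep r p, emb, _, Sum.inl false =>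
      .arith .sub (some r) (some r) none (emb (Sum.inr p.entry))
  | .rep _ p, emb, _, Sum.inr l => p.code (emb ∘ Sum.inr) (emb (Sum.inl true)) l

/-- The labels around a compiled program. -/
inductive Outer
  | start
  | test
  | yes
  | no
  deriving DecidableEq

instance : Fintype Outer where
  elems := {Outer.start, Outer.test, Outer.yes, Outer.no}
  complete := by intro x; cases x <;> simp

/-- The machine that runs `p` and answers yes iff it ends with a nonzero register `out`. -/
def Cmd.machine [Fintype R] [DecidableEq R] (p : Cmd R) (out : R) : Machine where
  Lbl := Outer ⊕ p.L
  Reg := Option R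
  start := Sum.inl .start
  code
    | Sum.inl .start => .const none 1 (Sum.inr p.entry)
    | Sum.inl .test => .ifLt (some out) none (Sum.inl .no) (Sum.inl .yes)
    | Sum.inl .yes => .halt true
    | Sum.inl .no => .halt false
    | Sum.inr l => p.code Sum.inr (Sum.inl .test) l

end Compile

/-! ### Correctness of the compilation -/

/-- `f` leads from `c` to `c'` in `k` steps, all of them inside `P`. -/
def Path {C : Type*} (f : C → C) (P : C → Prop) (k : ℕ) (c c' : C) : Prop :=
  f^[k] c = c' ∧ ∀ j ≤ k, P (f^[j] c)

theorem Path.last {C : Type*} {f : C → C} {P : C → Prop} {k : ℕ} {c c' : C}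
    (h : Path f P k c c') : P c' := h.1 ▸ h.2 k le_rfl

theorem Path.trans {C : Type*} {f : C → C} {P : C → Prop} {k l : ℕ} {c c' c'' : C}
    (h : Path f P k c c') (h' : Path f P l c' c'') : Path f P (k + l) c c'' := by
  refine ⟨by rw [add_comm, Function.iterate_add_apply, h.1, h'.1], fun j hj => ?_⟩
  rcases le_total j k with hjk | hjk
  · exact h.2 j hjk
  · obtain ⟨i, rfl⟩ := Nat.exists_eq_add_of_le hjk
    rw [add_comm, Function.iterate_add_apply, h.1]
    exact h'.2 i (by omega)

theorem Path.single {C : Type*} {f : C → C} {P : C → Prop} {c c' : C} (h : f c = c') (hc : P c)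
    (hc' : P c') : Path f P 1 c c' := by
  refine ⟨h, fun j hj => ?_⟩
  interval_cases j
  · exact hc
  · rwa [Function.iterate_one, h]

theorem Path.refl {C : Type*} {f : C → C} {P : C → Prop} {c : C} (hc : P c) : Path f P 0 c c :=
  ⟨rfl, fun j hj => by obtain rfl : j = 0 := by omega
                       exact hc⟩

/-- Contents of the registers of the compiled machine. -/
def extRegs {R : Type} (f : R → ℕ) : Option R → ℕ
  | none => 1
  | some r => f r

theorem extRegs_update {R : Type} [DecidableEq R] (f : R → ℕ) (d : R) (x : ℕ) :
    Function.update (extRegs f) (some d) x = extRegs (Function.update f d x) := by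
  funext r
  cases r <;> simp [extRegs, Function.update_apply]

section Simulation

variable {R : Type} [Fintype R] [DecidableEq R]

/-- The configuration of a machine at label `l` corresponding to a state. -/
def State.conf {p₀ : Cmd R} {out : R} (W : ℕ) (σ : State R) (l : Outer ⊕ p₀.L) :
    Config (p₀.machine out) W where
  lbl := l
  regs := extRegs σ.regs
  tape := fun i => σ.tape i
  coinPos := σ.pos

/-- The environment given by an oracle. -/
def GraphOracle.env {n : ℕ} {G : Digraph (Fin n)} (O : GraphOracle G) (s t : Fin n)
    (coins : ℕ → Bool) (W B : ℕ) : Env where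
  n := n
  s := s
  t := t
  deg := degQuery O.inList
  nbr := nbrQuery O.inList
  coins := coins
  W := W
  B := B

/-- All registers of `c` are below `B`. -/
def Config.Below {M : Machine} {W : ℕ} (B : ℕ) (c : Config M W) : Prop :=
  ∀ r, c.regs r < B

variable {n : ℕ} {G : Digraph (Fin n)} (O : GraphOracle G) (s t : Fin n) (coins : ℕ → Bool)
  {W B : ℕ} {p₀ : Cmd R} {out : R}

theorem conf_store (σ : State R) (l l' : Outer ⊕ p₀.L) (d : R) (x k : ℕ) :
    (σ.conf (out := out) W l).store (some d) x l' = (σ.set d x k).conf W l' := by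
  ext1
  · rfl
  · exact extRegs_update _ _ _
  · rfl
  · rfl

theorem conf_set_below {σ : State R} {l l' : Outer ⊕ p₀.L} {d : R} {x k : ℕ} (hx : x < B)
    (h : (σ.conf (out := out) W l).Below B) :
    ((σ.set d x k).conf (out := out) W l').Below B := by
  intro r
  have h' := h r
  rcases r with _ | r
  · exact h'
  · simp only [State.conf, State.set, extRegs, Function.update_apply] at h' ⊢
    split_ifs <;> assumption

theorem step_op (hB : 1 < B) (o : Op R) (σ : State R) (l l' : Outer ⊕ p₀.L)
    (hcode : (p₀.machine out).code l = o.instr l') (hs : o.Safe (O.env s t coins W B) σ)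
    (hb : (σ.conf (out := out) W l).Below B) :
    (p₀.machine out).step O s t coins (σ.conf W l) = (o.run (O.env s t coins W B) σ).conf W l' ∧
    ((o.run (O.env s t coins W B) σ).conf (out := out) W l').Below B := by
  have e : (σ.conf (p₀ := p₀) (out := out) W l).lbl = l := rfl
  unfold Machine.step
  rw [e, hcode]
  have hbit : ∀ b : Bool, b.toNat < B := fun b => lt_of_le_of_lt b.toNat_le hB
  cases o with
  | const d x => exact ⟨conf_store _ _ _ _ _ _, conf_set_below hs hb⟩
  | arith o d a b => exact ⟨conf_store _ _ _ _ _ _, conf_set_below hs hb⟩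
  | getN d => exact ⟨conf_store _ _ _ _ _ _, conf_set_below hs hb⟩
  | getS d => exact ⟨conf_store _ _ _ _ _ _, conf_set_below hs hb⟩
  | getT d => exact ⟨conf_store _ _ _ _ _ _, conf_set_below hs hb⟩
  | inDeg d v => exact ⟨conf_store _ _ _ _ _ _, conf_set_below hs hb⟩
  | inNbr d v i => exact ⟨conf_store _ _ _ _ _ _, conf_set_below hs hb⟩
  | readCat d i =>
    have hs' : (σ.conf (p₀ := p₀) (out := out) W l).regs (some i) < W := hs
    simp only [Op.instr, hs', dite_true]
    exact ⟨conf_store _ _ _ _ _ _, conf_set_below (hbit _) hb⟩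
  | writeCat i a =>
    have hs' : (σ.conf (p₀ := p₀) (out := out) W l).regs (some i) < W := hs
    simp only [Op.instr, hs', dite_true]
    refine ⟨?_, fun r => hb r⟩
    ext1
    · rfl
    · rfl
    · funext j
      simp only [State.conf, Op.run, Function.update_apply, Fin.ext_iff, extRegs]
      congr
    · rfl
  | flip d =>
    refine ⟨?_, fun r => conf_set_below (hbit (coins σ.pos)) hb (d := d) (k := 1) (l' := l') r⟩
    simp only [Op.instr]
    rw [conf_store _ _ _ _ _ 1]
    rfl

/-- Induction on `p` works because the placement `emb` and the continuation `exit` are arbitrary.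
`Path` carries the register bound through every intermediate configuration, and the clock is the
exact number of machine steps. -/
theorem simulation (hB : 1 < B) (p : Cmd R) (emb : p.L → Outer ⊕ p₀.L) (exit : Outer ⊕ p₀.L)
    (hcode : ∀ l, (p₀.machine out).code (emb l) = p.code emb exit l) (hwf : p.wf = true)
    (σ : State R) (hb : (σ.conf (out := out) W (emb p.entry)).Below B)
    (hs : p.Safe (O.env s t coins W B) σ) :
    ∃ k, (p.exec (O.env s t coins W B) σ).clock = σ.clock + k ∧
      Path ((p₀.machine out).step O s t coins) (Config.Below B) k
        (σ.conf W (emb p.entry)) ((p.exec (O.env s t coins W B) σ).conf W exit) := by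
  induction p generalizing exit σ with
  | op o =>
    obtain ⟨h1, h2⟩ := step_op O s t coins hB o σ _ _ (hcode ()) hs hb
    refine ⟨1, ?_, Path.single h1 hb h2⟩
    cases o <;> rfl
  | seq p q hp hq =>
    rw [Cmd.wf, Bool.and_eq_true] at hwf
    obtain ⟨k, hk, hk'⟩ := hp (emb ∘ Sum.inl) (emb (Sum.inr q.entry))
      (fun l => hcode (Sum.inl l)) hwf.1 σ hb hs.1
    obtain ⟨j, hj, hj'⟩ := hq (emb ∘ Sum.inr) exit (fun l => hcode (Sum.inr l)) hwf.2 _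
      hk'.last hs.2
    exact ⟨k + j, by rw [Cmd.exec, hj, hk, add_assoc], hk'.trans hj'⟩
  | rep r p hp =>
    rw [Cmd.wf, Bool.and_eq_true, Bool.not_eq_true'] at hwf
    rw [Cmd.Safe] at hs
    set E := O.env s t coins W B
    -- Induction on the counter at the loop head. The extra step in `k + 1` is the test that exits.
    have key : ∀ N (σ : State R), σ.regs r = N →
        ((σ.conf (out := out) W (emb (Sum.inl true))).Below B) →
        allDown (fun i τ => p.exec E (τ.set r i 2)) (fun i τ => p.Safe E (τ.set r i 2)) N σ →
        let τ := iterDown (fun i τ => p.exec E (State.set τ r i 2)) N σ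
        ∃ k, τ.clock = σ.clock + k ∧
          Path ((p₀.machine out).step O s t coins) (Config.Below B) (k + 1)
            (σ.conf W (emb (Sum.inl true))) (τ.conf W exit) := by
      intro N
      have htest : ∀ σ : State R, (p₀.machine out).step O s t coins
          (σ.conf W (emb (Sum.inl true))) =
          σ.conf W (if σ.regs r < 1 then exit else emb (Sum.inl false)) := by
        intro σ
        have e : (σ.conf (p₀ := p₀) (out := out) W (emb (Sum.inl true))).lbl = emb (Sum.inl true) :=
          rfl
        unfold Machine.step
        rw [e, hcode (Sum.inl true)]
        rfl
      induction N with
      | zero =>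
        intro σ hr hb _
        refine ⟨0, rfl, Path.single ?_ hb fun r => hb r⟩
        rw [htest, hr]
        rfl
      | succ N ih =>
        intro σ hr hb hs
        have h1 : Path ((p₀.machine out).step O s t coins) (Config.Below B) 1
            (σ.conf W (emb (Sum.inl true))) (σ.conf W (emb (Sum.inl false))) := by
          refine Path.single ?_ hb fun r => hb r
          rw [htest, hr, if_neg (by omega)]
        -- The decremented value needs no safety condition: the register held `N + 1 < B` before.
        have hNB : N < B := by
          have := hb (some r)
          simp only [State.conf, extRegs, hr] at this
          omega
        have h2 : Path ((p₀.machine out).step O s t coins) (Config.Below B) 1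
            (σ.conf W (emb (Sum.inl false))) ((σ.set r N 2).conf W (emb (Sum.inr p.entry))) := by
          refine Path.single ?_ h1.last (conf_set_below hNB h1.last)
          have e : (σ.conf (p₀ := p₀) (out := out) W (emb (Sum.inl false))).lbl =
            emb (Sum.inl false) := rfl
          unfold Machine.step
          rw [e, hcode (Sum.inl false)]
          simp only [Cmd.code]
          rw [conf_store _ _ _ _ _ 2]
          simp [State.conf, extRegs, ArithOp.eval, hr]
        obtain ⟨k, hk, hk'⟩ := hp (emb ∘ Sum.inr) (emb (Sum.inl true))
          (fun l => hcode (Sum.inr l)) hwf.2 (σ.set r N 2) h2.last hs.1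
        obtain ⟨j, hj, hj'⟩ := ih (p.exec E (σ.set r N 2))
          (by rw [p.frame E _ r hwf.1]; simp [State.set]) hk'.last hs.2
        refine ⟨2 + k + j, ?_, ?_⟩
        · simp only [iterDown]
          rw [hj, hk]
          simp only [State.set]
          omega
        · have := ((h1.trans h2).trans hk').trans hj'
          rwa [show 2 + k + j + 1 = 1 + 1 + k + (j + 1) by omega]
    obtain ⟨k, hk, hk'⟩ := key _ σ rfl hb hs
    refine ⟨k + 1, ?_, ?_⟩
    · simp only [Cmd.exec]
      rw [hk, add_assoc]
    · exact hk'

/-- If `p` is safe, then the compiled machine halts, with small registers all the time. -/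
theorem machine_run (hB : 1 < B) (hwf : p₀.wf = true) (T : ℕ) (x : ℕ → Bool)
    (Q : State R → Prop)
    (h : wp (O.env s t coins W B) p₀ (fun σ => Q σ ∧ σ.clock + 2 ≤ T) ⟨fun _ => 0, x, 0, 0⟩) :
    ∃ σ, Q σ ∧
      (∀ k, Config.Below B ((p₀.machine out).run O s t coins (fun i : Fin W => x i) k)) ∧
      ((p₀.machine out).run O s t coins (fun i : Fin W => x i) T).tape = (fun i : Fin W => σ.tape i) ∧
      ((p₀.machine out).run O s t coins (fun i : Fin W => x i) T).answer =
        some (decide (σ.regs out ≠ 0)) := by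
  set E := O.env s t coins W B with hE
  set σ₀ : State R := ⟨fun _ => 0, x, 0, 0⟩ with hσ₀
  obtain ⟨hsafe, hQ, hclock⟩ := h
  set σ := p₀.exec E σ₀ with hσ
  set f := (p₀.machine out).step O s t coins (W := W) with hf
  -- The two extra steps in the time bound are this load of `1` into the register `none` and the
  -- final test `h2`.
  have h1 : Path f (Config.Below B) 1 ((p₀.machine out).initial fun i : Fin W => x i)
      (σ₀.conf W (Sum.inr p₀.entry)) := by
    refine Path.single ?_ (fun r => by simp only [Machine.initial]; omega) ?_
    · simp only [hf, Machine.step, Machine.initial, Cmd.machine, Config.store, State.conf,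
        Config.mk.injEq, true_and, and_true, hσ₀]
      funext r
      cases r <;> simp [extRegs]
    · rintro (_ | r)
      · exact hB
      · simp only [State.conf, extRegs, hσ₀]
        omega
  obtain ⟨k, hk, hk'⟩ := simulation O s t coins hB p₀ Sum.inr (Sum.inl .test) (fun _ => rfl) hwf
    σ₀ h1.last hsafe
  have h2 : Path f (Config.Below B) 1 (σ.conf W (Sum.inl Outer.test))
      (σ.conf W (Sum.inl (if σ.regs out < 1 then Outer.no else Outer.yes))) := by
    refine Path.single ?_ hk'.last fun r => hk'.last r
    ext1
    · change (if σ.regs out < 1 then Sum.inl Outer.no else Sum.inl Outer.yes) = Sum.inl (if _ then _ else _)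
      split_ifs <;> rfl
    all_goals rfl
  have h3 := (h1.trans hk').trans h2
  have hfix : ∀ j, f^[j] (σ.conf W (Sum.inl (if σ.regs out < 1 then Outer.no else Outer.yes))) =
      σ.conf W (Sum.inl (if σ.regs out < 1 then Outer.no else Outer.yes)) := by
    intro j
    refine Function.iterate_fixed ?_ j
    split_ifs <;> rfl
  have hlate : ∀ j, 1 + k + 1 ≤ j →
      f^[j] ((p₀.machine out).initial fun i : Fin W => x i) =
        σ.conf W (Sum.inl (if σ.regs out < 1 then Outer.no else Outer.yes)) := by
    intro j hj
    obtain ⟨i, rfl⟩ := Nat.exists_eq_add_of_le' hj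
    rw [Function.iterate_add_apply, h3.1, hfix]
  have hk0 : σ.clock = 0 + k := hk
  have hT := hlate T (by omega)
  refine ⟨σ, hQ, fun j => ?_, ?_, ?_⟩
  · rcases le_total j (1 + k + 1) with hj | hj
    · exact h3.2 j hj
    · have := hlate j hj
      simp only [Machine.run]
      rw [this]
      exact h3.last
  · simp only [Machine.run]
    rw [hT]
    rfl
  · simp only [Machine.run]
    rw [hT]
    simp only [Config.answer, Cmd.machine, State.conf]
    by_cases h0 : σ.regs out = 0
    · simp [h0]
    · simp [h0]

end Simulation

/-! ### Pushing values along the edges -/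

section Push

/-- Add to the entry of `v`, modulo `M`, the values `h` takes at the entries of the in-neighbours
of `v`. -/
def addAt (M : ℕ) (h : ℕ → ℕ) (inn : ℕ → List ℕ) (x : ℕ → ℕ) (v : ℕ) : ℕ → ℕ :=
  Function.update x v ((x v + ((inn v).map fun u => h (x u)).sum) % M)

/-- The contribution of an entry `y`, for the shift `a` and the modulus `q`. -/
def gain (M a q y : ℕ) : ℕ := (y + a) % M % q

variable {M : ℕ} {inn : ℕ → List ℕ}

theorem gain_lt (hM : 0 < M) (a q y : ℕ) : gain M a q y < M :=
  lt_of_le_of_lt (Nat.mod_le _ _) (Nat.mod_lt _ hM)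

theorem addAt_lt (hM : 0 < M) (h : ℕ → ℕ) {x : ℕ → ℕ} (hx : ∀ v, x v < M) (w : ℕ) (v : ℕ) :
    addAt M h inn x w v < M := by
  rw [addAt, Function.update_apply]
  split_ifs
  · exact Nat.mod_lt _ hM
  · exact hx v

theorem foldl_addAt_lt (hM : 0 < M) (h : ℕ → ℕ) (l : List ℕ) {x : ℕ → ℕ} (hx : ∀ v, x v < M) :
    ∀ v, l.foldl (addAt M h inn) x v < M := by
  induction l generalizing x with
  | nil => exact hx
  | cons w l ih => exact ih (addAt_lt hM h hx w)

/-- As `v` is not its own in-neighbour, both pushes see the same neighbouring entries, and each pair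
`h`, `M - h` contributes exactly `M`. -/
theorem addAt_sub_addAt {h : ℕ → ℕ} (hh : ∀ y, h y ≤ M) {x : ℕ → ℕ} {v : ℕ} (hx : x v < M)
    (hv : v ∉ inn v) : addAt M (fun y => M - h y) inn (addAt M h inn x v) v = x := by
  have e : ∀ l : List ℕ, v ∉ l → ∀ z,
      (l.map fun u => M - h (Function.update x v z u)).sum + (l.map fun u => h (x u)).sum =
        M * l.length := by
    intro l hl z
    induction l with
    | nil => rfl
    | cons u l ih =>
      simp only [List.mem_cons, not_or] at hl
      have := ih hl.2
      have := hh (x u)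
      simp only [List.map_cons, List.sum_cons, List.length_cons,
        Function.update_of_ne (Ne.symm hl.1), mul_add]
      omega
  unfold addAt
  rw [Function.update_idem, Function.update_eq_self_iff, Function.update_self, Nat.mod_add_mod,
    add_assoc, add_comm (List.sum _), e _ hv, Nat.add_mul_mod_self_left, Nat.mod_eq_of_lt hx]

theorem foldl_sub_foldl_addAt (hM : 0 < M) {h : ℕ → ℕ} (hh : ∀ y, h y ≤ M)
    (hinn : ∀ v, v ∉ inn v) (l : List ℕ) {x : ℕ → ℕ} (hx : ∀ v, x v < M) :
    l.reverse.foldl (addAt M (fun y => M - h y) inn) (l.foldl (addAt M h inn) x) = x := by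
  induction l generalizing x with
  | nil => rfl
  | cons w l ih =>
    rw [List.reverse_cons, List.foldl_append, List.foldl_cons (l := l), ih (addAt_lt hM h hx w)]
    exact addAt_sub_addAt hh (hx w) (hinn w)

/-- Vertices that cannot be reached from `s` are not influenced by the entry of `s`. -/
theorem foldl_addAt_congr (h : ℕ → ℕ) (s : ℕ) (l : List ℕ) {x y : ℕ → ℕ}
    (hxy : ∀ v, ¬ Relation.ReflTransGen (fun u v => u ∈ inn v) s v → x v = y v) :
    ∀ v, ¬ Relation.ReflTransGen (fun u v => u ∈ inn v) s v →
      l.foldl (addAt M h inn) x v = l.foldl (addAt M h inn) y v := by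
  induction l generalizing x y with
  | nil => exact hxy
  | cons w l ih =>
    refine ih fun v hv => ?_
    rw [addAt, addAt, Function.update_apply, Function.update_apply]
    split_ifs with hvw
    · subst hvw
      rw [hxy v hv, List.map_congr_left fun u hu => ?_]
      -- An in-neighbour of an unreachable vertex is unreachable.
      rw [hxy u fun hr => hv (hr.tail hu)]
    · exact hxy v hv

/-! ### Counting the ways to reach a vertex -/

/-- The unbounded version of pushing, which counts the ways to reach a vertex. -/
def countAt (inn : ℕ → List ℕ) (c : ℕ → ℕ) (v : ℕ) : ℕ → ℕ :=
  Function.update c v (c v + ((inn v).map c).sum)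

theorem countAt_le {n b : ℕ} (hn : ∀ v, (inn v).length ≤ n) {c : ℕ → ℕ} (hc : ∀ v, c v ≤ b)
    (w v : ℕ) : countAt inn c w v ≤ (n + 1) * b := by
  rw [countAt, Function.update_apply]
  have h1 := hc v
  split_ifs with h
  · have h2 : ((inn w).map c).sum ≤ ((inn w).map c).length • b :=
      List.sum_le_card_nsmul _ _ (by simpa using fun u _ => hc u)
    have h3 : (inn w).length * b ≤ n * b := Nat.mul_le_mul_right _ (hn w)
    have h4 := hc w
    simp only [List.length_map, smul_eq_mul] at h2
    linarith
  · nlinarith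

theorem foldl_countAt_le {n b : ℕ} (hn : ∀ v, (inn v).length ≤ n) (l : List ℕ) {c : ℕ → ℕ}
    (hc : ∀ v, c v ≤ b) (v : ℕ) : l.foldl (countAt inn) c v ≤ (n + 1) ^ l.length * b := by
  induction l generalizing c b with
  | nil => simpa using hc v
  | cons w l ih =>
    refine (ih (countAt_le hn hc w)).trans ?_
    rw [List.length_cons, pow_succ, mul_assoc]

theorem le_countAt (c : ℕ → ℕ) (w v : ℕ) : c v ≤ countAt inn c w v := by
  rw [countAt, Function.update_apply]
  split_ifs with h
  · subst h
    omega
  · exact le_rfl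

theorem le_foldl_countAt (l : List ℕ) (c : ℕ → ℕ) (v : ℕ) :
    c v ≤ l.foldl (countAt inn) c v := by
  induction l generalizing c with
  | nil => exact le_rfl
  | cons w l ih => exact (le_countAt c w v).trans (ih _)

/-- Counts never decrease, so `u` is still positive when the turn of `v` comes, and `v` stays
positive afterwards. -/
theorem foldl_countAt_pos {l : List ℕ} {c : ℕ → ℕ} {u v : ℕ} (hc : 0 < c u) (huv : u ∈ inn v)
    (hv : v ∈ l) : 0 < l.foldl (countAt inn) c v := by
  induction l generalizing c with
  | nil => simp at hv
  | cons w l ih =>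
    rw [List.foldl_cons]
    by_cases hvw : v = w
    · subst hvw
      refine lt_of_lt_of_le ?_ (le_foldl_countAt l _ v)
      rw [countAt, Function.update_self]
      have : c u ≤ ((inn v).map c).sum := List.le_sum_of_mem (List.mem_map_of_mem huv)
      omega
    · exact ih (lt_of_lt_of_le hc (le_countAt c w u)) (by simpa [hvw] using hv)

theorem foldl_flatten_replicate_succ {α β : Type*} (f : β → α → β) (l : List α) (k : ℕ) (x : β) :
    (List.replicate (k + 1) l).flatten.foldl f x =
      l.foldl f ((List.replicate k l).flatten.foldl f x) := by
  rw [List.replicate_succ', List.flatten_append, List.foldl_append]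
  simp

/-- After `n` rounds, the count is positive at all vertices that can be reached from `s`. -/
theorem foldl_countAt_pos_of_reachable {n s t : ℕ} {l : List ℕ}
    (hinn : ∀ u v, u ∈ inn v → v < n) (hl : ∀ v < n, v ∈ l) {c : ℕ → ℕ} (hs : s < n)
    (hc : 0 < c s) (ht : Relation.ReflTransGen (fun u v => u ∈ inn v) s t) :
    0 < (List.replicate n l).flatten.foldl (countAt inn) c t := by
  set d : ℕ → ℕ → ℕ := fun k => (List.replicate k l).flatten.foldl (countAt inn) c with hd
  have hmono : ∀ k v, d k v ≤ d (k + 1) v := by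
    intro k v
    simp only [hd, foldl_flatten_replicate_succ]
    exact le_foldl_countAt _ _ _
  have hedge : ∀ k u v, u ∈ inn v → 0 < d k u → 0 < d (k + 1) v := by
    intro k u v huv hu
    simp only [hd, foldl_flatten_replicate_succ]
    exact foldl_countAt_pos hu huv (hl v (hinn u v huv))
  have hds : ∀ k, 0 < d k s := by
    intro k
    induction k with
    | zero => exact hc
    | succ k ih => exact ih.trans_le (hmono k s)
  -- If the set of positive vertices is closed under edges, it contains everything reachable;
  -- otherwise the next round enlarges it. After `n` rounds the second alternative would require `n
  -- + 1` vertices.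
  have key : ∀ k, (∀ v, Relation.ReflTransGen (fun u v => u ∈ inn v) s v → 0 < d k v) ∨
      k + 1 ≤ ((Finset.range n).filter fun v => 0 < d k v).card := by
    intro k
    induction k with
    | zero =>
      right
      exact Finset.card_pos.2 ⟨s, by simp [hs, hds 0]⟩
    | succ k ih =>
      rcases ih with ih | ih
      · exact Or.inl fun v hv => (ih v hv).trans_le (hmono k v)
      · by_cases hclosed : ∀ u v, u ∈ inn v → 0 < d k u → 0 < d k v
        · left
          intro v hv
          refine lt_of_lt_of_le ?_ (hmono k v)
          induction hv with
          | refl => exact hds k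
          | tail _ huv ih => exact hclosed _ _ huv ih
        · right
          push Not at hclosed
          obtain ⟨u, v, huv, hu, hv⟩ := hclosed
          refine lt_of_le_of_lt ih (Finset.card_lt_card ?_)
          refine (Finset.ssubset_iff_of_subset ?_).2 ⟨v, ?_, ?_⟩
          · intro w hw
            simp only [Finset.mem_filter] at hw ⊢
            exact ⟨hw.1, hw.2.trans_le (hmono k w)⟩
          · simp [hinn u v huv, hedge k u v huv hu]
          · simp [Nat.le_zero.1 hv]
  rcases key n with h | h
  · exact h t ht
  · have := (Finset.card_filter_le (Finset.range n) fun v => 0 < d n v)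
    rw [Finset.card_range] at this
    omega

/-- As long as no shifted entry overflows, the differences of the shifted entries of two states
behave like counts, modulo `q`. -/
theorem foldl_addAt_modEq {a q n : ℕ} (hq : 0 < q) (hn : ∀ v, (inn v).length ≤ n) (l : List ℕ)
    {x y c : ℕ → ℕ} (hx : ∀ v, (x v + a) % M + l.length * (n * q) < M)
    (hy : ∀ v, (y v + a) % M + l.length * (n * q) < M)
    (hxy : ∀ v, (y v + a) % M ≡ (x v + a) % M + c v [MOD q]) (v : ℕ) :
    (l.foldl (addAt M (gain M a q) inn) y v + a) % M ≡
      (l.foldl (addAt M (gain M a q) inn) x v + a) % M + l.foldl (countAt inn) c v [MOD q] := by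
  induction l generalizing x y c with
  | nil => exact hxy v
  | cons w l ih =>
    -- A push raises one shifted entry by at most `n * q`, which the slack pays for, so reduction
    -- modulo `M` changes nothing. Modulo `q`, each gain may then be replaced by the shifted entry
    -- of which it is the residue.
    have hstep : ∀ z : ℕ → ℕ, (∀ v, (z v + a) % M + (w :: l).length * (n * q) < M) → ∀ v,
        (addAt M (gain M a q) inn z w v + a) % M + l.length * (n * q) < M ∧
        (addAt M (gain M a q) inn z w v + a) % M ≡ if v = w then
          (z w + a) % M + ((inn w).map fun u => (z u + a) % M).sum else (z v + a) % M [MOD q] := by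
      intro z hz v
      have hzv := hz v
      rw [List.length_cons, add_mul, one_mul] at hzv
      rw [addAt, Function.update_apply]
      split_ifs with hvw
      · subst hvw
        have hsum : ((inn v).map fun u => gain M a q (z u)).sum ≤ n * q := by
          have h2 : ((inn v).map fun u => gain M a q (z u)).sum ≤
              ((inn v).map fun u => gain M a q (z u)).length • q := by
            refine List.sum_le_card_nsmul _ _ ?_
            simp only [List.mem_map, forall_exists_index, and_imp, forall_apply_eq_imp_iff₂]
            exact fun u _ => (Nat.mod_lt _ hq).le
          simp only [List.length_map, smul_eq_mul] at h2
          exact h2.trans (Nat.mul_le_mul_right _ (hn v))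
        have e : ((z v + ((inn v).map fun u => gain M a q (z u)).sum) % M + a) % M =
            (z v + a) % M + ((inn v).map fun u => gain M a q (z u)).sum := by
          rw [Nat.mod_add_mod, add_right_comm, Nat.add_mod, ← Nat.add_mod_mod,
            Nat.mod_mod, Nat.add_mod_mod, Nat.mod_eq_of_lt (by omega)]
        rw [e]
        refine ⟨by omega, Nat.ModEq.add_left _ ?_⟩
        generalize inn v = L
        induction L with
        | nil => rfl
        | cons u L ih =>
          simp only [List.map_cons, List.sum_cons]
          exact (Nat.mod_modEq _ _).add ih
      · exact ⟨by omega, rfl⟩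
    refine ih (fun v => (hstep x hx v).1) (fun v => (hstep y hy v).1) fun v => ?_
    refine (hstep y hy v).2.trans (Nat.ModEq.trans ?_ ((hstep x hx v).2.symm.add_right _))
    rw [countAt, Function.update_apply]
    split_ifs with hvw
    · rw [add_add_add_comm]
      refine (hxy w).add ?_
      generalize inn w = L
      induction L with
      | nil => rfl
      | cons u L ih =>
        simp only [List.map_cons, List.sum_cons]
        rw [add_add_add_comm]
        exact (hxy u).add ih
    · exact hxy v

end Push

/-! ### The test for a given seed -/

/-- The vertices in the order in which values are pushed to them. -/
def schedule (n : ℕ) : List ℕ := (List.replicate n (List.range n).reverse).flatten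

theorem length_schedule (n : ℕ) : (schedule n).length = n * n := by
  simp [schedule]

/-- The entry of `t` after pushing, if the entry of `s` is raised by `d` beforehand. -/
def outcome (M : ℕ) (inn : ℕ → List ℕ) (n s t : ℕ) (x : ℕ → ℕ) (a q d : ℕ) : ℕ :=
  (schedule n).foldl (addAt M (gain M a q) inn) (Function.update x s ((x s + d) % M)) t

theorem outcome_lt {M : ℕ} (hM : 0 < M) (inn : ℕ → List ℕ) (n s t : ℕ) {x : ℕ → ℕ}
    (hx : ∀ v, x v < M) (a q d : ℕ) : outcome M inn n s t x a q d < M := by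
  refine foldl_addAt_lt hM _ _ (fun v => ?_) t
  rw [Function.update_apply]
  split_ifs
  · exact Nat.mod_lt _ hM
  · exact hx v

theorem outcome_eq {M : ℕ} {inn : ℕ → List ℕ} {n s t : ℕ} (x : ℕ → ℕ) (a q d e : ℕ)
    (h : ¬ Relation.ReflTransGen (fun u v => u ∈ inn v) s t) :
    outcome M inn n s t x a q d = outcome M inn n s t x a q e := by
  refine foldl_addAt_congr _ s _ (fun v hv => ?_) t h
  have : v ≠ s := fun e => hv (e ▸ .refl)
  rw [Function.update_of_ne this, Function.update_of_ne this]

/-- The number of ways to reach `t` from `s` in the schedule. -/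
def pathCount (inn : ℕ → List ℕ) (n s t : ℕ) : ℕ :=
  (schedule n).foldl (countAt inn) (Pi.single s 1) t

theorem pathCount_pos {inn : ℕ → List ℕ} {n s t : ℕ} (hinn : ∀ u v, u ∈ inn v → v < n)
    (hs : s < n) (h : Relation.ReflTransGen (fun u v => u ∈ inn v) s t) :
    0 < pathCount inn n s t :=
  foldl_countAt_pos_of_reachable hinn (by simp) hs (by simp) h

theorem pathCount_le {inn : ℕ → List ℕ} {n s t : ℕ} (hn : ∀ v, (inn v).length ≤ n) :
    pathCount inn n s t ≤ (n + 1) ^ (n * n) := by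
  have := foldl_countAt_le hn (schedule n) (c := Pi.single s 1) (b := 1)
    (fun v => by rw [Pi.single_apply]; split_ifs <;> simp) t
  rwa [mul_one, length_schedule] at this

/-- The two runs start with shifted entries that differ by the indicator of `s`; the `+ 1` in `hx`
keeps this increment from wrapping around. Equal outcomes would force `q` to divide `pathCount`. -/
theorem outcome_ne {M : ℕ} {inn : ℕ → List ℕ} {n s t a q : ℕ} {x : ℕ → ℕ} (hq : 0 < q)
    (hn : ∀ v, (inn v).length ≤ n) (hx : ∀ v, (x v + a) % M + (n * n * (n * q) + 1) < M)
    (hdvd : ¬ q ∣ pathCount inn n s t) :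
    outcome M inn n s t x a q 0 ≠ outcome M inn n s t x a q 1 := by
  intro heq
  have h0 : ∀ v, (Function.update x s ((x s + 0) % M) v + a) % M = (x v + a) % M := by
    intro v
    rw [Function.update_apply]
    split_ifs with h
    · rw [h, add_zero, Nat.mod_add_mod]
    · rfl
  have h1 : ∀ v, (Function.update x s ((x s + 1) % M) v + a) % M =
      (x v + a) % M + (Pi.single s 1 : ℕ → ℕ) v := by
    intro v
    rw [Function.update_apply, Pi.single_apply]
    split_ifs with h
    · have := hx s
      rw [h, Nat.mod_add_mod, add_right_comm, ← Nat.mod_add_mod, Nat.mod_eq_of_lt (by omega)]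
    · rfl
  have hle : ∀ v, (Pi.single s 1 : ℕ → ℕ) v ≤ 1 := fun v => by
    rw [Pi.single_apply]; split_ifs <;> simp
  have key := foldl_addAt_modEq (M := M) (a := a) hq hn (schedule n)
    (x := Function.update x s ((x s + 0) % M)) (y := Function.update x s ((x s + 1) % M))
    (c := Pi.single s 1) (fun v => by rw [h0, length_schedule]; have := hx v; omega)
    (fun v => by rw [h1, length_schedule]; have := hx v; have := hle v; omega)
    (fun v => by rw [h0, h1]) t
  change (outcome M inn n s t x a q 1 + a) % M ≡ (outcome M inn n s t x a q 0 + a) % M +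
    pathCount inn n s t [MOD q] at key
  rw [heq] at key
  have key' : (outcome M inn n s t x a q 1 + a) % M + 0 ≡
    (outcome M inn n s t x a q 1 + a) % M + pathCount inn n s t [MOD q] := key
  exact hdvd (Nat.modEq_zero_iff_dvd.1 (Nat.ModEq.add_left_cancel' _ key').symm)

/-! ### Counting good seeds -/

/-- A Chebyshev-type lower bound for the number of primes below `2 ^ k`. -/
theorem two_pow_le_card_primes (k : ℕ) :
    2 ^ k ≤ k * (((Finset.range (2 ^ k)).filter Nat.Prime).card + 1) + 1 := by
  set P := (Finset.range (2 ^ k)).filter Nat.Prime with hP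
  have hpos : 1 ≤ 2 ^ k := Nat.one_le_two_pow
  have hPL : Nat.primesLE (2 ^ k - 1) = P := by
    ext p
    simp only [Nat.mem_primesLE, hP, Finset.mem_filter, Finset.mem_range]
    exact and_congr_left fun _ => by omega
  -- The least common multiple of the numbers below `2 ^ k` is large, but it is a product of one
  -- prime power per prime, each at most `2 ^ k`. So there must be many primes.
  have h1 := Chebyshev.two_pow_le_mul_lcmUpto (2 ^ k - 1)
  have h2 : Nat.lcmUpto (2 ^ k - 1) ≤ (2 ^ k) ^ P.card := by
    rw [Nat.lcmUpto_eq_prod_pow_log, hPL]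
    refine Finset.prod_le_pow_card _ _ _ fun p _ => ?_
    rcases Nat.eq_zero_or_pos (2 ^ k - 1) with h | h
    · rw [h]; simpa using hpos
    · exact (Nat.pow_log_le_self p h.ne').trans (Nat.sub_le _ _)
  have h3 : 2 ^ (2 ^ k - 1) ≤ 2 ^ (k * (P.card + 1)) := by
    refine h1.trans ((Nat.mul_le_mul_left _ h2).trans (le_of_eq ?_))
    rw [Nat.sub_add_cancel hpos, ← pow_succ', ← pow_mul]
  have := (Nat.pow_le_pow_iff_right (by norm_num : 1 < 2)).1 h3
  omega

theorem card_primeFactors_le {N e : ℕ} (hN : 0 < N) (h : N ≤ 2 ^ e) : N.primeFactors.card ≤ e := by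
  have h1 : 2 ^ N.primeFactors.card ≤ N := by
    calc 2 ^ N.primeFactors.card ≤ ∏ p ∈ N.primeFactors, p :=
          Finset.pow_card_le_prod _ _ _ fun p hp => (Nat.prime_of_mem_primeFactors hp).two_le
      _ ≤ N := Nat.le_of_dvd hN (Nat.prod_primeFactors_dvd N)
  exact (Nat.pow_le_pow_iff_right (by norm_num : 1 < 2)).1 (h1.trans h)

/-- Many primes do not divide a given number. -/
theorem card_good_moduli {N n ℓ : ℕ} (hℓ : 1 ≤ ℓ) (hn : n < 2 ^ ℓ) (hN : 0 < N)
    (hN' : N ≤ (n + 1) ^ (n * n)) :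
    2 ^ (8 * ℓ) ≤
      32 * ℓ * ((Finset.range (2 ^ (8 * ℓ))).filter fun q => 0 < q ∧ ¬ q ∣ N).card := by
  set u := 2 ^ ℓ with hu
  have hu2 : 2 ≤ u := by
    calc 2 = 2 ^ 1 := rfl
      _ ≤ u := Nat.pow_le_pow_right (by norm_num) hℓ
  have hℓu : ℓ ≤ u := Nat.lt_two_pow_self.le
  have hpf : N.primeFactors.card ≤ ℓ * (n * n) := by
    refine card_primeFactors_le hN (hN'.trans ?_)
    rw [pow_mul 2 ℓ]
    exact Nat.pow_le_pow_left hn _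
  have h1 := two_pow_le_card_primes (8 * ℓ)
  set P := (Finset.range (2 ^ (8 * ℓ))).filter Nat.Prime with hP
  set A := (Finset.range (2 ^ (8 * ℓ))).filter fun q => 0 < q ∧ ¬ q ∣ N with hA
  have h2 : P.card ≤ A.card + N.primeFactors.card := by
    rw [← Finset.card_sdiff_add_card_inter P N.primeFactors]
    refine Nat.add_le_add (Finset.card_le_card fun p hp => ?_)
      (Finset.card_le_card Finset.inter_subset_right)
    simp only [hP, hA, Finset.mem_sdiff, Finset.mem_filter, Nat.mem_primeFactors] at hp ⊢
    exact ⟨hp.1.1, hp.1.2.pos, fun h => hp.2 ⟨hp.1.2, h, hN.ne'⟩⟩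
  have h8 : 2 ^ (8 * ℓ) = u ^ 8 := by rw [hu, ← pow_mul, mul_comm]
  rw [h8] at h1 ⊢
  -- The primes dividing `N` and the lower-order terms cost `O(u ^ 4)`, less than three quarters of
  -- `u ^ 8`; this loss turns the factor `8 * ℓ` into `32 * ℓ`.
  have h3 : ℓ * (ℓ * (n * n)) ≤ u * (u * (u * u)) := by gcongr
  have h4 : ℓ * P.card ≤ ℓ * A.card + u * (u * (u * u)) := by
    calc ℓ * P.card ≤ ℓ * (A.card + ℓ * (n * n)) :=
          Nat.mul_le_mul_left _ (h2.trans (Nat.add_le_add_left hpf _))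
      _ = ℓ * A.card + ℓ * (ℓ * (n * n)) := by ring
      _ ≤ _ := Nat.add_le_add_left h3 _
  have h5 : 16 * (u * (u * (u * u))) ≤ u ^ 8 := by
    calc 16 * (u * (u * (u * u))) = 2 ^ 4 * u ^ 4 := by ring
      _ ≤ u ^ 4 * u ^ 4 := Nat.mul_le_mul_right _ (Nat.pow_le_pow_left hu2 4)
      _ = u ^ 8 := by ring
  have h6 : 8 * u ≤ u * (u * (u * u)) := by
    calc 8 * u = u * (2 * (2 * 2)) := by ring
      _ ≤ _ := by gcongr
  linarith

/-- Adding `x` permutes the residues, so the bad shifts inject into the top `D` residues. -/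
theorem card_bad_shifts (M D x : ℕ) :
    ((Finset.range M).filter fun a => M ≤ (x + a) % M + D).card ≤ D := by
  rcases Nat.eq_zero_or_pos M with rfl | hM
  · simp
  calc _ ≤ (Finset.Ico (M - D) M).card := by
        refine Finset.card_le_card_of_injOn (fun a => (x + a) % M) (fun a ha => ?_) ?_
        · simp only [Finset.coe_filter, Finset.mem_range, Set.mem_ofPred_eq, Finset.coe_Ico,
            Set.mem_Ico] at ha ⊢
          exact ⟨by omega, Nat.mod_lt _ hM⟩
        · intro a ha b hb hab
          simp only [Finset.coe_filter, Finset.mem_range, Set.mem_ofPred_eq] at ha hb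
          have : a ≡ b [MOD M] := Nat.ModEq.add_left_cancel' x hab
          rwa [Nat.ModEq, Nat.mod_eq_of_lt ha.1, Nat.mod_eq_of_lt hb.1] at this
    _ ≤ D := by rw [Nat.card_Ico]; omega

open scoped Classical in
/-- Most shifts avoid an overflow. -/
theorem card_good_shifts {M D n : ℕ} {x : ℕ → ℕ} (hx : ∀ v, n ≤ v → x v = 0)
    (hD : 2 * ((n + 1) * D) ≤ M) :
    M ≤ 2 * ((Finset.range M).filter fun a => ∀ v, (x v + a) % M + D < M).card := by
  have h1 := Finset.card_filter_add_card_filter_not (s := Finset.range M)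
    (fun a => ∀ v, (x v + a) % M + D < M)
  have h2 : ((Finset.range M).filter fun a => ¬ ∀ v, (x v + a) % M + D < M).card ≤ (n + 1) * D := by
    calc _ ≤ ((Finset.range (n + 1)).biUnion fun v =>
          (Finset.range M).filter fun a => M ≤ (x v + a) % M + D).card := by
          refine Finset.card_le_card fun a ha => ?_
          simp only [Finset.mem_filter, not_forall, not_lt, Finset.mem_biUnion,
            Finset.mem_range] at ha ⊢
          obtain ⟨ha, v, hv⟩ := ha
          rcases lt_or_ge v n with h | h
          · exact ⟨v, by omega, ha, hv⟩
          -- All entries from `n` on vanish, so the index `n` stands for them all in the union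
          -- bound.
          · exact ⟨n, by omega, ha, by rwa [hx n le_rfl, ← hx v h]⟩
      _ ≤ (Finset.range (n + 1)).card * D :=
          Finset.card_biUnion_le_card_mul _ _ _ fun v _ => card_bad_shifts M D (x v)
      _ = (n + 1) * D := by rw [Finset.card_range]
  rw [Finset.card_range] at h1
  omega

/-- The seeds that fail to detect a path. -/
def badSeeds (ℓ : ℕ) (inn : ℕ → List ℕ) (n s t : ℕ) (x : ℕ → ℕ) : Finset ℕ :=
  (Finset.range (2 ^ (24 * ℓ))).filter fun z =>
    outcome (2 ^ (16 * ℓ)) inn n s t x (z / 2 ^ (8 * ℓ)) (z % 2 ^ (8 * ℓ)) 0 =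
    outcome (2 ^ (16 * ℓ)) inn n s t x (z / 2 ^ (8 * ℓ)) (z % 2 ^ (8 * ℓ)) 1

open scoped Classical in
-- Quotient and remainder by `2 ^ (8 * ℓ)` make a seed the same as a pair of a shift and a modulus.
-- Pairs of a good modulus and a good shift are good seeds, so the densities `1 / (32 * ℓ)` and `1 /
-- 2` multiply.
theorem card_badSeeds {ℓ n s t : ℕ} {inn : ℕ → List ℕ} {x : ℕ → ℕ} (hn1 : 1 ≤ n)
    (hnℓ : n < 2 ^ ℓ) (hn : ∀ v, (inn v).length ≤ n) (hinn : ∀ u v, u ∈ inn v → v < n)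
    (hs : s < n) (hx : ∀ v, n ≤ v → x v = 0)
    (h : Relation.ReflTransGen (fun u v => u ∈ inn v) s t) :
    64 * ℓ * (badSeeds ℓ inn n s t x).card + 2 ^ (24 * ℓ) ≤ 64 * ℓ * 2 ^ (24 * ℓ) := by
  have hℓ : 1 ≤ ℓ := by
    rcases Nat.eq_zero_or_pos ℓ with rfl | h0
    · simp at hnℓ; omega
    · exact h0
  set u := 2 ^ ℓ with hu
  have hu2 : 2 ≤ u := by
    calc 2 = 2 ^ 1 := rfl
      _ ≤ u := Nat.pow_le_pow_right (by norm_num) hℓ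
  have h8 : 2 ^ (8 * ℓ) = u ^ 8 := by rw [hu, ← pow_mul, mul_comm]
  have h16 : 2 ^ (16 * ℓ) = u ^ 16 := by rw [hu, ← pow_mul, mul_comm]
  have h24 : 2 ^ (24 * ℓ) = u ^ 24 := by rw [hu, ← pow_mul, mul_comm]
  -- `D` bounds the drift over `n * n` pushes of at most `n * q` each; `q + 1 ≤ u ^ 8` leaves room
  -- for the unit added at `s`. Entries of `16 * ℓ` bits are long enough for `hDM`.
  set D := n * n * (n * u ^ 8) with hD
  have hDM : 2 * ((n + 1) * D) ≤ 2 ^ (16 * ℓ) := by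
    rw [h16, hD]
    calc 2 * ((n + 1) * (n * n * (n * u ^ 8))) ≤ u ^ 4 * (u * (u * u * (u * u ^ 8))) := by
          have h2 : 2 ≤ u ^ 4 := hu2.trans (Nat.le_self_pow (by norm_num) u)
          have h3 : n + 1 ≤ u := hnℓ
          have h4 : n ≤ u := by omega
          gcongr
      _ = u ^ 16 := by ring
  have hQ := card_good_moduli hℓ hnℓ (pathCount_pos hinn hs h) (pathCount_le hn)
  have hA := card_good_shifts hx hDM
  set Q := (Finset.range (2 ^ (8 * ℓ))).filter fun q => 0 < q ∧ ¬ q ∣ pathCount inn n s t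
  set A := (Finset.range (2 ^ (16 * ℓ))).filter fun a =>
    ∀ v, (x v + a) % 2 ^ (16 * ℓ) + D < 2 ^ (16 * ℓ)
  set F := badSeeds ℓ inn n s t x with hF
  set S := Finset.range (2 ^ (24 * ℓ)) \ F with hS
  have hFS : S.card + F.card = 2 ^ (24 * ℓ) := by
    rw [hS, Finset.card_sdiff_add_card_eq_card (hF ▸ Finset.filter_subset _ _), Finset.card_range]
  have hQA : Q.card * A.card ≤ S.card := by
    rw [← Finset.card_product]
    refine Finset.card_le_card_of_injOn (fun p => p.1 + 2 ^ (8 * ℓ) * p.2) ?_ ?_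
    · rintro ⟨q, a⟩ hp
      simp only [Finset.coe_product, Set.mem_prod, Finset.mem_coe, Q, A, Finset.mem_filter,
        Finset.mem_range] at hp
      obtain ⟨⟨hq, hq0, hqN⟩, ha, haD⟩ := hp
      have hz : q + 2 ^ (8 * ℓ) * a < 2 ^ (24 * ℓ) := by
        rw [show 24 * ℓ = 8 * ℓ + 16 * ℓ by ring, pow_add]
        calc q + 2 ^ (8 * ℓ) * a < 2 ^ (8 * ℓ) * (a + 1) := by rw [mul_add]; omega
          _ ≤ _ := Nat.mul_le_mul_left _ ha
      simp only [hS, hF, badSeeds, Finset.coe_sdiff, Finset.mem_coe, Finset.mem_range, Set.mem_sdiff,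
        Finset.mem_filter, hz, true_and, Nat.add_mul_mod_self_left, Nat.mod_eq_of_lt hq,
        Nat.add_mul_div_left _ _ (Nat.two_pow_pos (8 * ℓ)), Nat.div_eq_of_lt hq, zero_add]
      refine outcome_ne hq0 hn (fun v => lt_of_le_of_lt (Nat.add_le_add_left ?_ _) (haD v)) hqN
      rw [h8] at hq
      rw [hD, mul_left_comm _ n, mul_left_comm _ n]
      have : n * n * q + 1 ≤ n * n * u ^ 8 := by
        have h1 : n * n * (q + 1) ≤ n * n * u ^ 8 := Nat.mul_le_mul_left _ hq
        nlinarith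
      nlinarith
    · rintro ⟨q, a⟩ hp ⟨q', a'⟩ hp' heq
      simp only [Finset.coe_product, Set.mem_prod, Finset.mem_coe, Q, Finset.mem_filter,
        Finset.mem_range] at hp hp'
      simp only at heq
      have hmod := congrArg (· % 2 ^ (8 * ℓ)) heq
      have hdiv := congrArg (· / 2 ^ (8 * ℓ)) heq
      simp only [Nat.add_mul_mod_self_left, Nat.mod_eq_of_lt hp.1.1,
        Nat.mod_eq_of_lt hp'.1.1] at hmod
      simp only [Nat.add_mul_div_left _ _ (Nat.two_pow_pos (8 * ℓ)), Nat.div_eq_of_lt hp.1.1,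
        Nat.div_eq_of_lt hp'.1.1, zero_add] at hdiv
      rw [hmod, hdiv]
  have hprod : 2 ^ (24 * ℓ) ≤ 64 * ℓ * S.card := by
    calc 2 ^ (24 * ℓ) = 2 ^ (8 * ℓ) * 2 ^ (16 * ℓ) := by rw [← pow_add]; ring_nf
      _ ≤ (32 * ℓ * Q.card) * (2 * A.card) := Nat.mul_le_mul hQ hA
      _ = 64 * ℓ * (Q.card * A.card) := by ring
      _ ≤ _ := Nat.mul_le_mul_left _ hQA
  rw [← hFS] at hprod ⊢
  linarith

/-! ### Coin tosses -/

/-- The number with the binary digits `coins p, ..., coins (p + b - 1)`. -/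
def seedAt (coins : ℕ → Bool) (p : ℕ) : ℕ → ℕ
  | 0 => 0
  | b + 1 => 2 * seedAt coins p b + (coins (p + b)).toNat

theorem seedAt_lt (coins : ℕ → Bool) (p b : ℕ) : seedAt coins p b < 2 ^ b := by
  induction b with
  | zero => simp [seedAt]
  | succ b ih =>
    have := (coins (p + b)).toNat_le
    rw [seedAt, pow_succ]
    omega

theorem seedAt_inj {c c' : ℕ → Bool} {p b : ℕ} :
    seedAt c p b = seedAt c' p b ↔ ∀ i < b, c (p + i) = c' (p + i) := by
  induction b with
  | zero => simp [seedAt]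
  | succ b ih =>
    rw [Nat.forall_lt_succ_right, ← ih, seedAt, seedAt]
    cases c (p + b) <;> cases c' (p + b) <;> simp <;> omega

instance : IsProbabilityMeasure coinMeasure := by
  unfold coinMeasure
  infer_instance

/-- Extend a finite sequence of coin tosses. -/
def extendCoins {N : ℕ} (w : Finset.range N → Bool) (i : ℕ) : Bool :=
  if h : i ∈ Finset.range N then w ⟨i, h⟩ else false

theorem seedAt_extendCoins {N p b : ℕ} (c : ℕ → Bool) (h : p + b ≤ N) :
    seedAt (extendCoins ((Finset.range N).restrict c)) p b = seedAt c p b := by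
  refine seedAt_inj.2 fun i hi => ?_
  simp [extendCoins, show p + i < N by omega]

theorem block_le {j R b : ℕ} (hj : j < R) : j * b + b ≤ R * b := by
  rw [← Nat.succ_mul]
  exact Nat.mul_le_mul_right b hj

/-- The finite sequences of coin tosses with all seeds in `F`. -/
def seedsIn (F : Finset ℕ) (b R : ℕ) : Finset (Finset.range (R * b) → Bool) :=
  Finset.univ.filter fun w => ∀ j < R, seedAt (extendCoins w) (j * b) b ∈ F

/-- The `R` disjoint blocks cover all tosses, so a finite sequence is determined by its seeds. -/
theorem card_seedsIn_le (F : Finset ℕ) (b R : ℕ) : (seedsIn F b R).card ≤ F.card ^ R := by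
  have h : (Fintype.piFinset fun _ : Fin R => F).card = F.card ^ R := by simp
  rw [← h]
  refine Finset.card_le_card_of_injOn
    (fun w (j : Fin R) => seedAt (extendCoins w) (j * b) b) ?_ ?_
  · intro w hw
    simp only [seedsIn, Finset.coe_filter, Finset.mem_univ, true_and, Set.mem_ofPred_eq] at hw
    simpa using fun j : Fin R => hw j j.2
  · intro w _ w' _ heq
    funext ⟨i, hi⟩
    have hiN := Finset.mem_range.1 hi
    have hb : 0 < b := by
      rcases Nat.eq_zero_or_pos b with rfl | hb
      · simp at hiN
      · exact hb
    have hj : i / b < R := (Nat.div_lt_iff_lt_mul hb).2 hiN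
    have := seedAt_inj.1 (congrFun heq ⟨i / b, hj⟩) (i % b) (Nat.mod_lt _ hb)
    simp only [Nat.div_add_mod', extendCoins, hi, dite_true] at this
    exact this

/-- The event depends on finitely many tosses only, which gives its measurability and reduces its
measure to counting. -/
theorem setOf_seedAt_mem (F : Finset ℕ) (b R : ℕ) :
    {c : ℕ → Bool | ∀ j < R, seedAt c (j * b) b ∈ F} =
      (Finset.range (R * b)).restrict ⁻¹' (seedsIn F b R : Set _) := by
  ext c
  simp only [seedsIn, Finset.coe_filter, Finset.mem_univ, true_and, Set.mem_ofPred_eq,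
    Set.mem_preimage]
  exact forall₂_congr fun j hj => by rw [seedAt_extendCoins c (block_le hj)]

theorem measurableSet_seedAt_mem (F : Finset ℕ) (b R : ℕ) :
    MeasurableSet {c : ℕ → Bool | ∀ j < R, seedAt c (j * b) b ∈ F} := by
  rw [setOf_seedAt_mem]
  exact (Finset.measurable_restrict _) (Finset.measurableSet _)

theorem coinMeasure_seedAt_mem_le (F : Finset ℕ) (b R : ℕ) :
    coinMeasure {c : ℕ → Bool | ∀ j < R, seedAt c (j * b) b ∈ F} ≤
      ((F.card : ENNReal) * (2⁻¹) ^ b) ^ R := by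
  rw [setOf_seedAt_mem, coinMeasure]
  rw [← Measure.map_apply (Finset.measurable_restrict _) (Finset.measurableSet _),
    Measure.infinitePi_map_restrict, ← sum_measure_singleton]
  have h1 : ∀ w : Finset.range (R * b) → Bool,
      (Measure.pi fun _ : Finset.range (R * b) => (PMF.uniformOfFintype Bool).toMeasure) {w} =
        (2⁻¹) ^ (R * b) := by
    intro w
    rw [Measure.pi_singleton]
    simp
  rw [Finset.sum_congr rfl fun w _ => h1 w, Finset.sum_const, nsmul_eq_mul, mul_pow, ← pow_mul,
    mul_comm b R]
  gcongr
  exact_mod_cast card_seedsIn_le F b R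

/-- By `hF` the density of `F` is at most `1 - 1 / R ≤ exp (-1 / R)`, so `R` independent seeds all
lie in `F` with probability at most `1 / e ≤ 1 / 2`. Only the event `T` has to be measurable, not
`S`. -/
theorem one_half_le_coinMeasure {F : Finset ℕ} {b R : ℕ} (hR : 0 < R)
    (hF : R * F.card + 2 ^ b ≤ R * 2 ^ b) {S : Set (ℕ → Bool)}
    (hS : ∀ c, (∃ j < R, seedAt c (j * b) b ∉ F) → c ∈ S) : 1 / 2 ≤ coinMeasure S := by
  set T := {c : ℕ → Bool | ∀ j < R, seedAt c (j * b) b ∈ F} with hT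
  have hTS : Tᶜ ⊆ S := fun c hc => hS c (by
    simp only [hT, Set.mem_compl_iff, Set.mem_ofPred_eq] at hc
    push Not at hc
    exact hc)
  have hTle : coinMeasure T ≤ 1 / 2 := by
    refine (coinMeasure_seedAt_mem_le F b R).trans ?_
    have hreal : ((F.card : ℝ) * (2⁻¹) ^ b) ^ R ≤ 1 / 2 := by
      have hR' : (0 : ℝ) < R := by exact_mod_cast hR
      have h1 : (F.card : ℝ) * (2⁻¹) ^ b ≤ Real.exp (-(1 / R)) := by
        have hF' : (R : ℝ) * F.card + 2 ^ b ≤ R * 2 ^ b := by exact_mod_cast hF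
        refine le_trans ?_ (Real.add_one_le_exp _)
        rw [inv_pow, ← div_eq_mul_inv, div_le_iff₀ (by positivity)]
        have : (F.card : ℝ) ≤ (R * 2 ^ b - 2 ^ b) / R := by
          rw [le_div_iff₀ hR']
          linarith
        refine this.trans (le_of_eq ?_)
        field_simp
        ring
      calc ((F.card : ℝ) * (2⁻¹) ^ b) ^ R ≤ Real.exp (-(1 / R)) ^ R :=
            pow_le_pow_left₀ (by positivity) h1 R
        _ = Real.exp (-1) := by
            rw [← Real.exp_nat_mul]
            congr 1
            field_simp
        _ ≤ 1 / 2 := by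
            rw [Real.exp_neg, one_div]
            have := Real.add_one_le_exp 1
            gcongr
            linarith
    have h2 := ENNReal.ofReal_le_ofReal hreal
    rw [ENNReal.ofReal_pow (by positivity), ENNReal.ofReal_mul (by positivity),
      ENNReal.ofReal_natCast, ENNReal.ofReal_pow (by positivity),
      ENNReal.ofReal_inv_of_pos (by norm_num), ENNReal.ofReal_div_of_pos (by norm_num)] at h2
    simpa using h2
  calc (1 / 2 : ENNReal) = 1 - 1 / 2 := by simp
    _ ≤ 1 - coinMeasure T := tsub_le_tsub_left hTle 1
    _ = coinMeasure Tᶜ := (prob_compl_eq_one_sub (measurableSet_seedAt_mem F b R)).symm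
    _ ≤ coinMeasure S := measure_mono hTS

/-! ### The program -/

/-- The work registers. -/
inductive Rg
  | one | two | nN | s | t | K | M | Q | len
  | ell | pw | tmp | cnt | trials | rounds | vcount | ecount | bcount | scount
  | z | q | a | vtx | nb | ad | x | f | idx | base | bit | y | y0 | y1 | found
  deriving DecidableEq

instance : Fintype Rg where
  elems := {Rg.one, Rg.two, Rg.nN, Rg.s, Rg.t, Rg.K, Rg.M, Rg.Q, Rg.len, Rg.ell, Rg.pw, Rg.tmp,
    Rg.cnt, Rg.trials, Rg.rounds, Rg.vcount, Rg.ecount, Rg.bcount, Rg.scount, Rg.z, Rg.q, Rg.a,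
    Rg.vtx, Rg.nb, Rg.ad, Rg.x, Rg.f, Rg.idx, Rg.base, Rg.bit, Rg.y, Rg.y0, Rg.y1, Rg.found}
  complete := by intro r; cases r <;> decide

/-- Sequential composition. -/
infixr:60 " ;; " => Cmd.seq

/-- A word operation as a program. -/
def arith (o : ArithOp) (d b c : Rg) : Cmd Rg := .op (.arith o d b c)

/-- Load a constant. -/
def const (d : Rg) (x : ℕ) : Cmd Rg := .op (.const d x)

/-- Copy the contents of a register. -/
def copy (d b : Rg) : Cmd Rg := arith .mul d b .one

/-- Read the entry of the vertex in `ad` into `x`. -/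
def readEntry : Cmd Rg :=
  arith .mul .base .ad .K ;; const .x 0 ;; copy .bcount .K ;;
  -- The counter descends, so the most significant bit comes first and Horner's rule applies.
  .rep .bcount (arith .add .idx .base .bcount ;; .op (.readCat .bit .idx) ;;
    arith .mul .x .x .two ;; arith .add .x .x .bit)

/-- Write `x` to the entry of the vertex in `ad`. -/
def writeEntry : Cmd Rg :=
  arith .mul .base .ad .K ;; copy .y .x ;; copy .bcount .K ;;
  .rep .bcount (arith .mod .bit .y .two ;; arith .div .y .y .two ;;
    .op (.writeCat .base .bit) ;; arith .add .base .base .one)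

/-- Add `f` modulo `M` to the entry of the vertex in `ad`. -/
def addEntry : Cmd Rg :=
  readEntry ;; arith .add .x .x .f ;; arith .mod .x .x .M ;; writeEntry

/-- Negate the contribution `f` if the direction is backward. -/
def orient (back : Bool) : Cmd Rg := if back then arith .sub .f .M .f else copy .f .f

/-- Process the edge number `ecount` into `vtx`. -/
def pushEdge (back : Bool) : Cmd Rg :=
  .op (.inNbr .nb .vtx .ecount) ;; arith .sub .ad .nb .one ;; readEntry ;;
  arith .add .x .x .a ;; arith .mod .x .x .M ;; arith .mod .f .x .q ;; orient back ;;
  copy .ad .vtx ;; addEntry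

/-- Select the vertex to be processed. -/
def selectVertex (back : Bool) : Cmd Rg :=
  -- Loop counters descend: forward rounds visit `n - 1, ..., 0`, and backward rounds reflect the
  -- counter.
  if back then arith .sub .vtx .nN .one ;; arith .sub .vtx .vtx .vcount else copy .vtx .vcount

/-- Process all edges into one vertex. -/
def pushVertex (back : Bool) : Cmd Rg :=
  selectVertex back ;; .op (.inDeg .ecount .vtx) ;; .rep .ecount (pushEdge back)

/-- Process all vertices. -/
def pushRound (back : Bool) : Cmd Rg := copy .vcount .nN ;; .rep .vcount (pushVertex back)

/-- Process all vertices `n` times. -/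
def sweep (back : Bool) : Cmd Rg := copy .rounds .nN ;; .rep .rounds (pushRound back)

/-- Compute the outcome for the increment `d` at `s` into `out`, and restore the tape. -/
def experiment (d : ℕ) (out : Rg) : Cmd Rg :=
  const .f d ;; copy .ad .s ;; addEntry ;; sweep false ;; copy .ad .t ;; readEntry ;;
  copy out .x ;; sweep true ;; const .f d ;; arith .sub .f .M .f ;; copy .ad .s ;; addEntry

/-- Toss the coins for a seed. -/
def sample : Cmd Rg :=
  const .z 0 ;; copy .scount .len ;;
  .rep .scount (.op (.flip .bit) ;; arith .mul .z .z .two ;; arith .add .z .z .bit) ;;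
  arith .mod .q .z .Q ;; arith .div .a .z .Q

/-- One trial. -/
def trial : Cmd Rg :=
  sample ;; experiment 0 .y0 ;; experiment 1 .y1 ;;
  -- The two truncated differences add up to `|y0 - y1|`, so `found` stays `0` iff all outcomes
  -- agree.
  arith .sub .bit .y0 .y1 ;; arith .add .found .found .bit ;;
  arith .sub .bit .y1 .y0 ;; arith .add .found .found .bit

/-- Compute the parameters. -/
def setup : Cmd Rg :=
  .op (.getN .nN) ;; .op (.getS .s) ;; .op (.getT .t) ;; const .one 1 ;; const .two 2 ;;
  const .ell 0 ;; const .pw 1 ;; copy .cnt .nN ;;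
  -- A branch-free conditional: `tmp` is `1` as long as `pw ≤ n` and `0` afterwards, so `pw` doubles
  -- until it exceeds `n`.
  .rep .cnt (arith .sub .tmp .pw .nN ;; arith .sub .tmp .one .tmp ;; arith .add .ell .ell .tmp ;;
    arith .add .tmp .one .tmp ;; arith .mul .pw .pw .tmp) ;;
  arith .mul .pw .pw .pw ;; arith .mul .pw .pw .pw ;; arith .mul .Q .pw .pw ;;
  arith .mul .M .Q .Q ;; const .K 16 ;; arith .mul .K .K .ell ;; const .len 24 ;;
  arith .mul .len .len .ell ;; const .trials 64 ;; arith .mul .trials .trials .ell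

/-- The program deciding reachability. -/
def reachability : Cmd Rg := setup ;; .rep .trials trial

/-! ### Its verification -/

/-- The tape holding the entries `X`, with `K` bits each. -/
def enc (K : ℕ) (X : ℕ → ℕ) (i : ℕ) : Bool := (X (i / K)).testBit (i % K)

theorem enc_apply {K i : ℕ} (X : ℕ → ℕ) (v : ℕ) (hi : i < K) :
    enc K X (v * K + i) = (X v).testBit i := by
  have h1 : (v * K + i) / K = v := by
    rw [add_comm, Nat.add_mul_div_right _ _ (by omega), Nat.div_eq_of_lt hi, zero_add]
  have h2 : (v * K + i) % K = i := by
    rw [add_comm, Nat.add_mul_mod_self_right, Nat.mod_eq_of_lt hi]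
  rw [enc, h1, h2]

/-- The assumptions under which the program is verified. -/
structure Setup (E : Env) (inn : ℕ → List ℕ) (ℓ K M Q : ℕ) : Prop where
  deg : ∀ v < E.n, E.deg v = (inn v).length
  nbr : ∀ v < E.n, ∀ i, ∀ h : i < (inn v).length, E.nbr v i = (inn v)[i] + 1
  inn_lt : ∀ u v, u ∈ inn v → u < E.n
  not_mem : ∀ v, v ∉ inn v
  length_le : ∀ v, (inn v).length ≤ E.n
  s_lt : E.s < E.n
  t_lt : E.t < E.n
  n_lt : E.n < 2 ^ ℓ
  -- Together with `n_lt` this determines `ℓ`, so that the value computed by `setup` must agree with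
  -- it.
  le_n : 2 ^ ℓ ≤ 2 * E.n
  K_eq : K = 16 * ℓ
  M_eq : M = 2 ^ K
  Q_eq : Q = 2 ^ (8 * ℓ)
  W_eq : E.W = E.n * K
  -- `M * M` takes `32 * ℓ` bits; the remaining `8 * ℓ` bits absorb constant factors up to `256`.
  B_eq : E.B = 2 ^ (40 * ℓ)

namespace Setup

variable {E : Env} {inn : ℕ → List ℕ} {ℓ K M Q : ℕ} (h : Setup E inn ℓ K M Q)

include h

theorem one_le_ell : 1 ≤ ℓ := by
  rcases Nat.eq_zero_or_pos ℓ with rfl | h0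
  · have := h.n_lt; have := h.s_lt; simp at *; omega
  · exact h0

theorem M_pos : 0 < M := h.M_eq ▸ Nat.two_pow_pos K

/-- The relations between the sizes of the numbers that occur. -/
theorem sizes : 16 ≤ K ∧ K ≤ M ∧ E.n ≤ M ∧ Q ≤ M ∧ E.n * K ≤ M * M ∧ K * M ≤ M * M ∧
    M ≤ M * M ∧ 2 ^ (24 * ℓ) ≤ M * M ∧ 256 * (M * M) ≤ E.B := by
  have hℓ := h.one_le_ell
  have h1 : 16 ≤ K := by rw [h.K_eq]; omega
  have h2 : K ≤ M := by rw [h.M_eq]; exact Nat.lt_two_pow_self.le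
  have hM : M = 2 ^ (16 * ℓ) := by rw [h.M_eq, h.K_eq]
  have h3 : E.n ≤ M := h.n_lt.le.trans (hM ▸ Nat.pow_le_pow_right (by norm_num) (by omega))
  refine ⟨h1, h2, h3, ?_, Nat.mul_le_mul h3 h2, Nat.mul_le_mul_right _ h2,
    Nat.le_mul_of_pos_left _ h.M_pos, ?_, ?_⟩
  · rw [h.Q_eq, hM]
    exact Nat.pow_le_pow_right (by norm_num) (by omega)
  · rw [hM, ← pow_add]
    exact Nat.pow_le_pow_right (by norm_num) (by omega)
  · rw [hM, h.B_eq, ← pow_add, show 256 = 2 ^ 8 by norm_num, ← pow_add]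
    exact Nat.pow_le_pow_right (by norm_num) (by omega)

end Setup

/-- The registers that are constant after the setup. -/
structure Consts (E : Env) (ℓ K M Q : ℕ) (r : Rg → ℕ) : Prop where
  one : r .one = 1
  two : r .two = 2
  nN : r .nN = E.n
  s : r .s = E.s
  t : r .t = E.t
  K : r .K = K
  M : r .M = M
  Q : r .Q = Q
  len : r .len = 24 * ℓ

/-- `p` does not write to the constant registers. -/
abbrev Cmd.Keeps (p : Cmd Rg) : Prop :=
  ∀ r ∈ [Rg.one, .two, .nN, .s, .t, .K, .M, .Q, .len], p.writes r = false

theorem Consts.of_frame {E : Env} {ℓ K M Q : ℕ} {σ τ : State Rg} (h : Consts E ℓ K M Q σ.regs)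
    {p : Cmd Rg} (fr : Frame p σ τ) (hp : p.Keeps) : Consts E ℓ K M Q τ.regs := by
  have e : ∀ r ∈ [Rg.one, .two, .nN, .s, .t, .K, .M, .Q, .len], τ.regs r = σ.regs r :=
    fun r hr => fr r (hp r hr)
  simp only [List.forall_mem_cons] at e
  obtain ⟨e1, e2, e3, e4, e5, e6, e7, e8, e9, -⟩ := e
  exact ⟨e1.trans h.one, e2.trans h.two, e3.trans h.nN, e4.trans h.s, e5.trans h.t, e6.trans h.K,
    e7.trans h.M, e8.trans h.Q, e9.trans h.len⟩

theorem Consts.update {E : Env} {ℓ K M Q : ℕ} {r : Rg → ℕ} (h : Consts E ℓ K M Q r) {d : Rg}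
    {x : ℕ} (hd : d ∉ [Rg.one, .two, .nN, .s, .t, .K, .M, .Q, .len]) :
    Consts E ℓ K M Q (Function.update r d x) := by
  simp only [List.mem_cons, List.not_mem_nil, or_false, not_or] at hd
  obtain ⟨d1, d2, d3, d4, d5, d6, d7, d8, d9⟩ := hd
  constructor
  · rw [Function.update_of_ne (Ne.symm d1), h.one]
  · rw [Function.update_of_ne (Ne.symm d2), h.two]
  · rw [Function.update_of_ne (Ne.symm d3), h.nN]
  · rw [Function.update_of_ne (Ne.symm d4), h.s]
  · rw [Function.update_of_ne (Ne.symm d5), h.t]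
  · rw [Function.update_of_ne (Ne.symm d6), h.K]
  · rw [Function.update_of_ne (Ne.symm d7), h.M]
  · rw [Function.update_of_ne (Ne.symm d8), h.Q]
  · rw [Function.update_of_ne (Ne.symm d9), h.len]

section Specs

variable {E : Env} {inn : ℕ → List ℕ} {ℓ K M Q : ℕ}

/-! ### Specifications: access to single entries -/

theorem readEntry_spec (h : Setup E inn ℓ K M Q) {σ : State Rg} (hc : Consts E ℓ K M Q σ.regs)
    {X : ℕ → ℕ} (hX : ∀ v, X v < M) (htape : σ.tape = enc K X) (hv : σ.regs .ad < E.n) :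
    wp E readEntry (fun τ => τ.regs .x = X (σ.regs .ad) ∧ τ.tape = enc K X ∧ τ.pos = σ.pos ∧
      τ.clock ≤ σ.clock + 7 * K) σ := by
  obtain ⟨b1, b2, b3, b4, b5, b6, b7, b8, b9⟩ := h.sizes
  set v := σ.regs .ad with hvdef
  have hvK : v * K + K ≤ E.n * K := by rw [← Nat.succ_mul]; exact Nat.mul_le_mul_right K hv
  have hXv := hX v
  simp only [readEntry, arith, const, copy, wp_seq, wp_op, Op.Safe, Op.run, State.set,
    ArithOp.eval, ne_eq, reduceCtorEq, not_false_eq_true,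
    Function.update_of_ne, ← hvdef, hc.K, hc.one, mul_one]
  refine ⟨by omega, by omega, by omega, ?_⟩
  refine (wp_rep (fun i r tp p => r .x = X v / 2 ^ i ∧ tp = enc K X ∧ p = σ.pos)
    (fun _ => 4) ?_ ?_).conseq ?_
  · simp [htape, ← h.M_eq, Nat.div_eq_of_lt hXv]
  · rintro i τ hi ⟨hx, htp, hp⟩ fr
    simp only [Function.update_self] at hi
    have f1 := fr .base rfl
    have f2 := fr .two rfl
    simp only [ne_eq, reduceCtorEq, not_false_eq_true, Function.update_of_ne,
      Function.update_self, hc.two] at f1 f2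
    have hdiv : X v / 2 ^ (i + 1) * 2 + ((X v).testBit i).toNat = X v / 2 ^ i := by
      rw [Nat.toNat_testBit, pow_succ, ← Nat.div_div_eq_div_mul]
      omega
    have hle : X v / 2 ^ i ≤ X v := Nat.div_le_self _ _
    simp only [wp_seq, wp_op, Op.Safe, Op.run, State.set,
      ArithOp.eval, Function.update_self, ne_eq, reduceCtorEq, not_false_eq_true,
      Function.update_of_ne, f1, f2, htp, enc_apply X v hi, hx, hdiv, h.W_eq]
    refine ⟨by omega, by omega, by omega, by omega, ⟨trivial, trivial, hp⟩, by omega⟩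
  · rintro τ ⟨⟨hx, htp, hp⟩, hcl⟩ fr
    simp only [Function.update_self, Finset.sum_const, Finset.card_range, smul_eq_mul] at hcl
    exact ⟨by simpa using hx, htp, hp, by omega⟩

theorem writeEntry_spec (h : Setup E inn ℓ K M Q) {σ : State Rg} (hc : Consts E ℓ K M Q σ.regs)
    {X : ℕ → ℕ} (hx : σ.regs .x < M) (htape : σ.tape = enc K X) (hv : σ.regs .ad < E.n) :
    wp E writeEntry (fun τ => τ.tape = enc K (Function.update X (σ.regs .ad) (σ.regs .x)) ∧
      τ.pos = σ.pos ∧ τ.clock ≤ σ.clock + 7 * K) σ := by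
  obtain ⟨b1, b2, b3, b4, b5, b6, b7, b8, b9⟩ := h.sizes
  set v := σ.regs .ad with hvdef
  set w := σ.regs .x with hwdef
  have hvK : v * K + K ≤ E.n * K := by rw [← Nat.succ_mul]; exact Nat.mul_le_mul_right K hv
  simp only [writeEntry, arith, copy, wp_seq, wp_op, Op.Safe, Op.run, State.set,
    ArithOp.eval, ne_eq, reduceCtorEq, not_false_eq_true,
    Function.update_of_ne, ← hvdef, ← hwdef, hc.K, hc.one, mul_one]
  refine ⟨by omega, by omega, by omega, ?_⟩
  -- The tape agrees with the new encoding below the current position and with the old one from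
  -- there on. This holds at the start because the blocks before `v` are the same in both.
  refine (wp_rep (fun i r tp p => r .base = v * K + (K - i) ∧ r .y = w / 2 ^ (K - i) ∧
    (∀ j, tp j = if j < v * K + (K - i) then enc K (Function.update X v w) j else enc K X j) ∧
      p = σ.pos) (fun _ => 4) ?_ ?_).conseq ?_
  · simp only [Function.update_self, ne_eq, reduceCtorEq, not_false_eq_true, Function.update_of_ne,
      Nat.sub_self, pow_zero, Nat.div_one, add_zero, true_and, and_true, htape]
    intro j
    split_ifs with hj
    · have : j / K ≠ v := by
        have := (Nat.div_lt_iff_lt_mul (by omega : 0 < K)).2 hj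
        omega
      rw [enc, enc, Function.update_of_ne this]
    · rfl
  · rintro i τ hi ⟨hbase, hy, htp, hp⟩ fr
    simp only [Function.update_self] at hi
    have f1 := fr .one rfl
    have f2 := fr .two rfl
    simp only [ne_eq, reduceCtorEq, not_false_eq_true, Function.update_of_ne, hc.two,
      hc.one] at f1 f2
    set j := K - (i + 1) with hj
    have hj' : K - i = j + 1 := by omega
    have hle : w / 2 ^ j ≤ w := Nat.div_le_self _ _
    have hdiv : w / 2 ^ j / 2 = w / 2 ^ (j + 1) := by rw [pow_succ, Nat.div_div_eq_div_mul]
    simp only [wp_seq, wp_op, Op.Safe, Op.run, State.set,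
      ArithOp.eval, Function.update_self, ne_eq, reduceCtorEq, not_false_eq_true,
      Function.update_of_ne, f1, f2, hbase, hy, h.W_eq, hj']
    refine ⟨by omega, by omega, by omega, by omega, ⟨by ring, hdiv, fun k => ?_, hp⟩, by omega⟩
    rw [Function.update_apply, htp]
    by_cases hk : k = v * K + j
    · rw [if_pos hk, if_pos (by omega), hk, enc_apply _ v (by omega), Function.update_self,
        Nat.testBit_eq_decide_div_mod_eq]
      congr 1
      simp
    · rw [if_neg hk]
      exact if_congr (by omega) rfl rfl
  · rintro τ ⟨⟨-, -, htp, hp⟩, hcl⟩ fr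
    simp only [Function.update_self, Finset.sum_const, Finset.card_range, smul_eq_mul] at hcl
    refine ⟨funext fun j => ?_, hp, by omega⟩
    rw [htp]
    split_ifs with hj
    · rfl
    · have : j / K ≠ v := by
        rintro e
        have := (Nat.div_lt_iff_lt_mul (x := j) (y := v + 1) (by omega : 0 < K)).1 (by omega)
        rw [add_mul] at this
        omega
      rw [enc, enc, Function.update_of_ne this]

theorem addEntry_spec (h : Setup E inn ℓ K M Q) {σ : State Rg} (hc : Consts E ℓ K M Q σ.regs)
    {X : ℕ → ℕ} (hX : ∀ v, X v < M) (htape : σ.tape = enc K X) (hv : σ.regs .ad < E.n)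
    (hf : σ.regs .f ≤ M) :
    wp E addEntry (fun τ => τ.tape = enc K (Function.update X (σ.regs .ad)
      ((X (σ.regs .ad) + σ.regs .f) % M)) ∧ τ.pos = σ.pos ∧ τ.clock ≤ σ.clock + 15 * K) σ := by
  obtain ⟨b1, b2, b3, b4, b5, b6, b7, b8, b9⟩ := h.sizes
  rw [addEntry, wp_seq]
  refine wp.conseq (readEntry_spec h hc hX htape hv) fun τ ⟨hx, htp, hp, hcl⟩ fr => ?_
  have hc' := hc.of_frame fr (by decide)
  have f1 := fr .ad rfl
  have f2 := fr .f rfl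
  have hXv := hX (σ.regs .ad)
  have hmod := Nat.mod_lt (X (σ.regs .ad) + σ.regs .f) h.M_pos
  simp only [arith, wp_seq, wp_op, Op.Safe, Op.run, State.set,
    ArithOp.eval, Function.update_self, ne_eq, reduceCtorEq, not_false_eq_true,
    Function.update_of_ne, hx, f2, hc'.M]
  refine ⟨by omega, by omega, ?_⟩
  refine wp.conseq (writeEntry_spec h (X := X) ((hc'.update (by decide)).update (by decide))
    (by simpa using hmod) htp (by simpa [f1] using hv)) ?_
  rintro τ' ⟨h1, h2, h3⟩ _
  simp only [Function.update_self, ne_eq, reduceCtorEq, not_false_eq_true,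
    Function.update_of_ne, f1] at h1 h2 h3
  exact ⟨h1, by omega, by omega⟩

/-- The contribution of an entry `y`, depending on the direction. -/
def weight (back : Bool) (M a q y : ℕ) : ℕ :=
  if back then M - gain M a q y else gain M a q y

theorem weight_le (hM : 0 < M) (back : Bool) (a q y : ℕ) : weight back M a q y ≤ M := by
  have := gain_lt hM a q y
  unfold weight
  split_ifs <;> omega

theorem orient_spec (h : Setup E inn ℓ K M Q) (back : Bool) {σ : State Rg}
    (hc : Consts E ℓ K M Q σ.regs) (hf : σ.regs .f ≤ M) :
    wp E (orient back) (fun τ => τ.regs .f = (if back then M - σ.regs .f else σ.regs .f) ∧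
      τ.tape = σ.tape ∧ τ.pos = σ.pos ∧ τ.clock ≤ σ.clock + 1) σ := by
  obtain ⟨b1, b2, b3, b4, b5, b6, b7, b8, b9⟩ := h.sizes
  cases back <;>
  simp [orient, arith, copy, wp_op, Op.Safe, Op.run, State.set, ArithOp.eval, hc.M, hc.one] <;>
  omega

/-! ### Specifications: pushing along edges, rounds and sweeps -/

theorem pushEdge_spec (h : Setup E inn ℓ K M Q) (back : Bool) {σ : State Rg}
    (hc : Consts E ℓ K M Q σ.regs) {X : ℕ → ℕ} (hX : ∀ v, X v < M) (htape : σ.tape = enc K X)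
    {v i : ℕ} (hv : σ.regs .vtx = v) (hvn : v < E.n) (hi : σ.regs .ecount = i)
    (hil : i < (inn v).length) (ha : σ.regs .a ≤ M * M) :
    wp E (pushEdge back) (fun τ => τ.tape = enc K (Function.update X v
      ((X v + weight back M (σ.regs .a) (σ.regs .q) (X (inn v)[i])) % M)) ∧ τ.pos = σ.pos ∧
      τ.clock ≤ σ.clock + 23 * K) σ := by
  obtain ⟨b1, b2, b3, b4, b5, b6, b7, b8, b9⟩ := h.sizes
  have hu := h.inn_lt _ v (List.getElem_mem hil)
  set u := (inn v)[i] with hudef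
  have hXu := hX u
  simp only [pushEdge, arith, wp_seq, wp_op, Op.Safe, Op.run, State.set,
    ArithOp.eval, Function.update_self, ne_eq, reduceCtorEq, not_false_eq_true,
    Function.update_of_ne, hv, hi, h.nbr v hvn i hil, ← hudef, hc.one, Nat.add_sub_cancel]
  refine ⟨by omega, by omega, ?_⟩
  refine wp.conseq (readEntry_spec h ((hc.update (by decide)).update (by decide)) hX htape
    (by simpa using hu)) ?_
  rintro τ ⟨hx, htp, hp, hcl⟩ fr
  have hc' := ((hc.update (d := .nb) (x := u + 1) (by decide)).update (d := .ad) (x := u)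
    (by decide))
  -- `Frame` and `Consts` only look at registers, so the clock of the intermediate state is
  -- irrelevant.
  have hc' : Consts E ℓ K M Q τ.regs := Consts.of_frame (σ := ⟨_, σ.tape, σ.pos, 0⟩) hc' fr (by decide)
  have f1 := fr .vtx rfl
  have f2 := fr .a rfl
  have f3 := fr .q rfl
  simp only [ne_eq, reduceCtorEq, not_false_eq_true, Function.update_of_ne,
    Function.update_self] at f1 f2 f3 hx hp hcl
  have hmod := Nat.mod_lt (X u + σ.regs .a) h.M_pos
  have hmod2 : (X u + σ.regs .a) % M % σ.regs .q ≤ (X u + σ.regs .a) % M := Nat.mod_le _ _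
  simp only [wp_seq, wp_op, Op.Safe, Op.run, State.set,
    ArithOp.eval, Function.update_self, ne_eq, reduceCtorEq, not_false_eq_true,
    Function.update_of_ne, f2, f3, hx, hc'.M]
  refine ⟨by omega, by omega, by omega, ?_⟩
  have hc2 := ((hc'.update (d := .x) (x := X u + σ.regs .a) (by decide)).update (d := .x)
    (x := (X u + σ.regs .a) % M) (by decide)).update (d := .f)
    (x := (X u + σ.regs .a) % M % σ.regs .q) (by decide)
  refine wp.conseq (orient_spec h back hc2 (by simp only [Function.update_self]; omega)) ?_
  rintro τ' ⟨hf', htp', hp', hcl'⟩ fr'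
  have hc3 : Consts E ℓ K M Q τ'.regs :=
    hc2.of_frame (σ := ⟨_, σ.tape, σ.pos, 0⟩) fr' (by cases back <;> decide)
  have f1' := fr' .vtx (by cases back <;> rfl)
  simp only [ne_eq, reduceCtorEq, not_false_eq_true, Function.update_of_ne,
    Function.update_self, f1, hv] at f1' hf' htp' hp' hcl'
  replace hf' : τ'.regs .f = weight back M (σ.regs .a) (σ.regs .q) (X u) := hf'
  simp only [copy, arith, wp_seq, wp_op, Op.Safe, Op.run, State.set, ArithOp.eval, f1', hc3.one,
    mul_one]
  refine ⟨by omega, ?_⟩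
  refine wp.conseq (addEntry_spec h (hc3.update (by decide)) hX (htp'.trans htp) (by simpa using hvn)
    (by simpa [hf'] using weight_le h.M_pos _ _ _ _)) ?_
  rintro τ2 ⟨htp2, hp2, hcl2⟩ _
  simp only [ne_eq, reduceCtorEq, not_false_eq_true, Function.update_of_ne,
    Function.update_self, hf'] at htp2 hp2 hcl2
  exact ⟨htp2, by omega, by omega⟩

theorem selectVertex_spec (h : Setup E inn ℓ K M Q) (back : Bool) {σ : State Rg}
    (hc : Consts E ℓ K M Q σ.regs) (hi : σ.regs .vcount < E.n) :
    wp E (selectVertex back) (fun τ =>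
      τ.regs .vtx = (if back then E.n - 1 - σ.regs .vcount else σ.regs .vcount) ∧
      τ.tape = σ.tape ∧ τ.pos = σ.pos ∧ τ.clock ≤ σ.clock + 2) σ := by
  obtain ⟨b1, b2, b3, b4, b5, b6, b7, b8, b9⟩ := h.sizes
  cases back <;>
  simp [selectVertex, arith, copy, wp_seq, wp_op, Op.Safe, Op.run, State.set, ArithOp.eval,
    hc.nN, hc.one] <;>
  omega

theorem pushVertex_spec (h : Setup E inn ℓ K M Q) (back : Bool) {σ : State Rg}
    (hc : Consts E ℓ K M Q σ.regs) {X : ℕ → ℕ} (hX : ∀ v, X v < M) (htape : σ.tape = enc K X)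
    (hi : σ.regs .vcount < E.n) (ha : σ.regs .a ≤ M * M) {v : ℕ}
    (hv : v = if back then E.n - 1 - σ.regs .vcount else σ.regs .vcount) :
    wp E (pushVertex back) (fun τ =>
      τ.tape = enc K (addAt M (weight back M (σ.regs .a) (σ.regs .q)) inn X v) ∧
      τ.pos = σ.pos ∧ τ.clock ≤ σ.clock + 4 + (inn v).length * (24 * K)) σ := by
  obtain ⟨b1, b2, b3, b4, b5, b6, b7, b8, b9⟩ := h.sizes
  have hvn : v < E.n := by
    rw [hv]
    split_ifs <;> omega
  have hlen := h.length_le v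
  rw [pushVertex, wp_seq]
  refine wp.conseq (selectVertex_spec h back hc hi) fun τ ⟨hx, htp, hp, hcl⟩ fr => ?_
  rw [← hv] at hx
  have hc1 : Consts E ℓ K M Q τ.regs := hc.of_frame fr (by cases back <;> decide)
  have f1 := fr .a (by cases back <;> rfl)
  have f2 := fr .q (by cases back <;> rfl)
  simp only [wp_seq, wp_op, Op.Safe, Op.run, State.set, hx, h.deg v hvn]
  refine ⟨by omega, ?_⟩
  set w := weight back M (σ.regs .a) (σ.regs .q) with hw
  have hc2 := hc1.update (d := .ecount) (x := (inn v).length) (by decide)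
  -- The counter descends, so with `i` iterations left the in-neighbours from index `i` on have been
  -- added.
  refine (wp_rep (fun i r tp p => tp = enc K (Function.update X v
    ((X v + (((inn v).drop i).map fun u => w (X u)).sum) % M)) ∧ p = σ.pos)
    (fun _ => 23 * K) ?_ ?_).conseq ?_
  · simp [Nat.mod_eq_of_lt (hX v), htp, htape, hp]
  · rintro i τ1 hi ⟨htp1, hp1⟩ fr1
    simp only [Function.update_self] at hi
    have hc3 : Consts E ℓ K M Q τ1.regs :=
      hc2.of_frame (σ := ⟨_, σ.tape, σ.pos, 0⟩) fr1 (by cases back <;> decide)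
    have g1 := fr1 .a (by cases back <;> rfl)
    have g2 := fr1 .q (by cases back <;> rfl)
    have g3 := fr1 .vtx (by cases back <;> rfl)
    simp only [ne_eq, reduceCtorEq, not_false_eq_true, Function.update_of_ne, f1, f2,
      hx] at g1 g2 g3
    have hX' : ∀ v', Function.update X v
        ((X v + (((inn v).drop (i + 1)).map fun u => w (X u)).sum) % M) v' < M := by
      intro v'
      rw [Function.update_apply]
      split_ifs
      · exact Nat.mod_lt _ h.M_pos
      · exact hX v'
    refine wp.conseq (pushEdge_spec h back (σ := τ1.set .ecount i 2) (hc3.update (by decide)) hX' htp1 (v := v) (i := i)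
      (by simpa [State.set] using g3) hvn (by simp [State.set]) hi
      (by simpa [State.set, g1] using ha)) ?_
    rintro τ2 ⟨htp2, hp2, hcl2⟩ _
    simp only [State.set, ne_eq, reduceCtorEq, not_false_eq_true, Function.update_of_ne, g1, g2,
      ← hw, Function.update_self, Function.update_idem] at htp2 hp2 hcl2
    refine ⟨⟨?_, hp2.trans hp1⟩, by omega⟩
    -- Without loops, the entry read is not the one being modified.
    have hne : (inn v)[i] ≠ v := fun e =>
      h.not_mem v (by simpa only [e] using List.getElem_mem hi)
    rw [htp2, Function.update_of_ne hne, List.drop_eq_getElem_cons hi, List.map_cons,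
      List.sum_cons, Nat.mod_add_mod, add_right_comm, add_assoc]
  · rintro τ1 ⟨⟨htp1, hp1⟩, hcl1⟩ _
    simp only [Function.update_self, Finset.sum_const, Finset.card_range, smul_eq_mul] at hcl1
    refine ⟨htp1, hp1, hcl1.trans ?_⟩
    have : (inn v).length * (23 * K + 2) ≤ (inn v).length * (24 * K) :=
      Nat.mul_le_mul_left _ (by omega)
    omega

/-- The order in which a round processes the vertices. -/
def order (back : Bool) (n : ℕ) : List ℕ :=
  if back then List.range n else (List.range n).reverse

theorem length_order (back : Bool) (n : ℕ) : (order back n).length = n := by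
  cases back <;> simp [order]

theorem drop_order (back : Bool) {n i : ℕ} (hi : i < n) :
    (order back n).drop (n - (i + 1)) =
      (if back then n - 1 - i else i) :: (order back n).drop (n - i) := by
  rw [List.drop_eq_getElem_cons (by rw [length_order]; omega),
    show n - (i + 1) + 1 = n - i by omega]
  congr 1
  cases back
  · simp [order]
    omega
  · simp [order]
    omega

theorem pushRound_spec (h : Setup E inn ℓ K M Q) {m : ℕ} (hnm : E.n ≤ m)
    (hm : ∑ v ∈ Finset.range E.n, (inn v).length ≤ m) (back : Bool) {σ : State Rg}
    (hc : Consts E ℓ K M Q σ.regs) {X : ℕ → ℕ} (hX : ∀ v, X v < M) (htape : σ.tape = enc K X)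
    (ha : σ.regs .a ≤ M * M) :
    wp E (pushRound back) (fun τ =>
      τ.tape = enc K ((order back E.n).foldl
        (addAt M (weight back M (σ.regs .a) (σ.regs .q)) inn) X) ∧
      τ.pos = σ.pos ∧ τ.clock ≤ σ.clock + 25 * (K * m)) σ := by
  obtain ⟨b1, b2, b3, b4, b5, b6, b7, b8, b9⟩ := h.sizes
  set w := weight back M (σ.regs .a) (σ.regs .q) with hw
  set L := order back E.n with hL
  simp only [pushRound, copy, arith, wp_seq, wp_op, Op.Safe, Op.run, State.set, ArithOp.eval,
    hc.nN, hc.one, mul_one]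
  refine ⟨by omega, ?_⟩
  have hc1 := hc.update (d := .vcount) (x := E.n) (by decide)
  -- The invariant looks forward: pushing the remaining vertices from the present entries yields the
  -- final ones.
  refine (wp_rep (fun i r tp p => ∃ Y : ℕ → ℕ, tp = enc K Y ∧ (∀ v, Y v < M) ∧
      (L.drop (E.n - i)).foldl (addAt M w inn) Y = L.foldl (addAt M w inn) X ∧ p = σ.pos)
    (fun i => 4 + (inn (if back then E.n - 1 - i else i)).length * (24 * K)) ?_ ?_).conseq ?_
  · exact ⟨X, htape, hX, by simp, rfl⟩
  · rintro i τ hi ⟨Y, htp, hY, hfold, hp⟩ fr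
    simp only [Function.update_self] at hi
    have hc2 : Consts E ℓ K M Q τ.regs :=
      hc1.of_frame (σ := ⟨_, σ.tape, σ.pos, 0⟩) fr (by cases back <;> decide)
    have f1 := fr .a (by cases back <;> rfl)
    have f2 := fr .q (by cases back <;> rfl)
    simp only [ne_eq, reduceCtorEq, not_false_eq_true, Function.update_of_ne] at f1 f2
    refine wp.conseq (pushVertex_spec h back (σ := τ.set .vcount i 2) (hc2.update (by decide)) hY htp
      (by simpa [State.set] using hi) (by simpa [State.set, f1] using ha) rfl) ?_
    rintro τ1 ⟨htp1, hp1, hcl1⟩ _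
    simp only [State.set, ne_eq, reduceCtorEq, not_false_eq_true, Function.update_of_ne, f1, f2,
      ← hw, Function.update_self] at htp1 hp1 hcl1
    refine ⟨⟨_, htp1, addAt_lt h.M_pos _ hY _, ?_, hp1.trans hp⟩, by omega⟩
    rw [← hfold, hL, drop_order back hi, List.foldl_cons]
  · rintro τ ⟨⟨Y, htp, -, hfold, hp⟩, hcl⟩ _
    rw [Nat.sub_zero, List.drop_of_length_le (by rw [hL, length_order]), List.foldl_nil] at hfold
    refine ⟨hfold ▸ htp, hp, hcl.trans ?_⟩
    have hsum : ∑ i ∈ Finset.range E.n, (inn (if back then E.n - 1 - i else i)).length ≤ m := by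
      refine le_trans (le_of_eq ?_) hm
      cases back
      · simp
      · simpa using Finset.sum_range_reflect (fun i => (inn i).length) E.n
    simp only [Function.update_self, Finset.sum_add_distrib, ← Finset.sum_mul, Finset.sum_const,
      Finset.card_range, smul_eq_mul]
    have h1 := Nat.mul_le_mul_right (24 * K) hsum
    have h2 : 16 * m ≤ K * m := Nat.mul_le_mul_right m b1
    have h3 := h.s_lt
    have h4 : m * (24 * K) = 24 * (K * m) := by ring
    omega

theorem sweep_spec (h : Setup E inn ℓ K M Q) {m : ℕ} (hnm : E.n ≤ m)
    (hm : ∑ v ∈ Finset.range E.n, (inn v).length ≤ m) (back : Bool) {σ : State Rg}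
    (hc : Consts E ℓ K M Q σ.regs) {X : ℕ → ℕ} (hX : ∀ v, X v < M) (htape : σ.tape = enc K X)
    (ha : σ.regs .a ≤ M * M) :
    wp E (sweep back) (fun τ =>
      τ.tape = enc K ((List.replicate E.n (order back E.n)).flatten.foldl
        (addAt M (weight back M (σ.regs .a) (σ.regs .q)) inn) X) ∧
      τ.pos = σ.pos ∧ τ.clock ≤ σ.clock + 26 * (K * (E.n * m))) σ := by
  obtain ⟨b1, b2, b3, b4, b5, b6, b7, b8, b9⟩ := h.sizes
  set w := weight back M (σ.regs .a) (σ.regs .q) with hw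
  simp only [sweep, copy, arith, wp_seq, wp_op, Op.Safe, Op.run, State.set, ArithOp.eval,
    hc.nN, hc.one, mul_one]
  refine ⟨by omega, ?_⟩
  have hc1 := hc.update (d := .rounds) (x := E.n) (by decide)
  refine (wp_rep (fun i r tp p => ∃ Y : ℕ → ℕ, tp = enc K Y ∧ (∀ v, Y v < M) ∧
      (List.replicate i (order back E.n)).flatten.foldl (addAt M w inn) Y =
        (List.replicate E.n (order back E.n)).flatten.foldl (addAt M w inn) X ∧ p = σ.pos)
    (fun _ => 25 * (K * m)) ?_ ?_).conseq ?_
  · exact ⟨X, htape, hX, by simp, rfl⟩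
  · rintro i τ hi ⟨Y, htp, hY, hfold, hp⟩ fr
    have hc2 : Consts E ℓ K M Q τ.regs :=
      hc1.of_frame (σ := ⟨_, σ.tape, σ.pos, 0⟩) fr (by cases back <;> decide)
    have f1 := fr .a (by cases back <;> rfl)
    have f2 := fr .q (by cases back <;> rfl)
    simp only [ne_eq, reduceCtorEq, not_false_eq_true, Function.update_of_ne] at f1 f2
    refine wp.conseq (pushRound_spec h hnm hm back (σ := τ.set .rounds i 2) (hc2.update (by decide)) hY htp
      (by simpa [State.set, f1] using ha)) ?_
    rintro τ1 ⟨htp1, hp1, hcl1⟩ _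
    simp only [State.set, ne_eq, reduceCtorEq, not_false_eq_true, Function.update_of_ne, f1, f2,
      ← hw] at htp1 hp1 hcl1
    refine ⟨⟨_, htp1, foldl_addAt_lt h.M_pos _ _ hY, ?_, hp1.trans hp⟩, by omega⟩
    rw [← hfold, List.replicate_succ, List.flatten_cons, List.foldl_append]
  · rintro τ ⟨⟨Y, htp, -, hfold, hp⟩, hcl⟩ _
    refine ⟨hfold ▸ htp, hp, hcl.trans ?_⟩
    simp only [Function.update_self, Finset.sum_const, Finset.card_range, smul_eq_mul]
    have h3 := h.s_lt
    have h2 : 16 * (E.n * m) ≤ K * (E.n * m) := Nat.mul_le_mul_right _ b1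
    have h4 : E.n * 1 ≤ E.n * m := Nat.mul_le_mul_left _ (by omega)
    have h5 : E.n * (25 * (K * m) + 2) = 25 * (K * (E.n * m)) + 2 * E.n := by ring
    omega

/-- The two directions of the sweep cancel. -/
theorem sweep_cancel (h : Setup E inn ℓ K M Q) (a q : ℕ) {X : ℕ → ℕ} (hX : ∀ v, X v < M) :
    (List.replicate E.n (order true E.n)).flatten.foldl (addAt M (weight true M a q) inn)
      ((List.replicate E.n (order false E.n)).flatten.foldl (addAt M (weight false M a q) inn) X) =
      X := by
  have key := foldl_sub_foldl_addAt h.M_pos (h := gain M a q)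
    (fun y => (gain_lt h.M_pos a q y).le) h.not_mem (schedule E.n) hX
  have e : (schedule E.n).reverse = (List.replicate E.n (order true E.n)).flatten := by
    simp [schedule, order, List.reverse_flatten]
  rw [e] at key
  exact key

/-! ### Specifications: experiments, trials and the whole program -/

theorem experiment_spec (h : Setup E inn ℓ K M Q) {m : ℕ} (hnm : E.n ≤ m)
    (hm : ∑ v ∈ Finset.range E.n, (inn v).length ≤ m) {d : ℕ} (hd : d ≤ 1) {out : Rg}
    (hout : out = .y0 ∨ out = .y1) {σ : State Rg}
    (hc : Consts E ℓ K M Q σ.regs) {X : ℕ → ℕ} (hX : ∀ v, X v < M) (htape : σ.tape = enc K X)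
    (ha : σ.regs .a ≤ M * M) :
    wp E (experiment d out) (fun τ =>
      τ.regs out = outcome M inn E.n E.s E.t X (σ.regs .a) (σ.regs .q) d ∧
      τ.tape = enc K X ∧ τ.pos = σ.pos ∧ τ.clock ≤ σ.clock + 100 * (K * (E.n * m))) σ := by
  obtain ⟨b1, b2, b3, b4, b5, b6, b7, b8, b9⟩ := h.sizes
  have hs := h.s_lt
  have ht := h.t_lt
  have hnm1 : 1 ≤ E.n * m := Nat.mul_pos (by omega) (by omega)
  have hKnm : K * 1 ≤ K * (E.n * m) := Nat.mul_le_mul_left _ hnm1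
  set a := σ.regs .a with hadef
  set q := σ.regs .q with hqdef
  set X1 := Function.update X E.s ((X E.s + d) % M) with hX1
  have hX1lt : ∀ v, X1 v < M := by
    intro v
    rw [hX1, Function.update_apply]
    split_ifs
    · exact Nat.mod_lt _ h.M_pos
    · exact hX v
  set X2 := (List.replicate E.n (order false E.n)).flatten.foldl
    (addAt M (weight false M a q) inn) X1 with hX2
  have hX2lt : ∀ v, X2 v < M := foldl_addAt_lt h.M_pos _ _ hX1lt
  -- Forward weights and order unfold to `gain` and `schedule`.
  have hX2t : X2 E.t = outcome M inn E.n E.s E.t X a q d := rfl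
  have hX2t' := hX2lt E.t
  simp only [experiment, const, copy, arith, wp_seq, wp_op, Op.Safe, Op.run, State.set,
    ArithOp.eval, Function.update_of_ne, ne_eq, reduceCtorEq, not_false_eq_true, hc.s, hc.one,
    mul_one]
  refine ⟨by omega, by omega, ?_⟩
  have hc1 := (hc.update (d := .f) (x := d) (by decide)).update (d := .ad) (x := E.s) (by decide)
  refine wp.conseq (addEntry_spec h hc1 hX htape (by simpa using hs)
    (by simp; omega)) ?_
  rintro τ1 ⟨htp1, hp1, hcl1⟩ fr1
  have hc2 : Consts E ℓ K M Q τ1.regs :=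
    hc1.of_frame (σ := ⟨_, σ.tape, σ.pos, 0⟩) fr1 (by decide)
  have g1 := fr1 .a rfl
  have g2 := fr1 .q rfl
  simp only [ne_eq, reduceCtorEq, not_false_eq_true, Function.update_of_ne, Function.update_self,
    ← hX1, ← hadef, ← hqdef] at htp1 hp1 hcl1 g1 g2
  rw [wp_seq]
  refine wp.conseq (sweep_spec h hnm hm false hc2 hX1lt htp1 (g1 ▸ ha)) ?_
  rintro τ2 ⟨htp2, hp2, hcl2⟩ fr2
  have hc3 := hc2.of_frame fr2 (by decide)
  have g1' := (fr2 .a rfl).trans g1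
  have g2' := (fr2 .q rfl).trans g2
  rw [g1, g2, ← hX2] at htp2
  simp only [wp_seq, wp_op, Op.Safe, Op.run, State.set, ArithOp.eval, hc3.t, hc3.one,
    mul_one]
  refine ⟨by omega, ?_⟩
  have hc4 := hc3.update (d := .ad) (x := E.t) (by decide)
  refine wp.conseq (readEntry_spec h hc4 hX2lt htp2 (by simpa using ht)) ?_
  rintro τ3 ⟨hx3, htp3, hp3, hcl3⟩ fr3
  have hc5 : Consts E ℓ K M Q τ3.regs :=
    hc4.of_frame (σ := ⟨_, σ.tape, σ.pos, 0⟩) fr3 (by decide)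
  have k1 := fr3 .a rfl
  have k2 := fr3 .q rfl
  simp only [ne_eq, reduceCtorEq, not_false_eq_true, Function.update_of_ne, Function.update_self,
    g1', g2', hX2t] at hx3 hp3 hcl3 k1 k2
  simp only [wp_seq, wp_op, Op.Safe, Op.run, State.set, ArithOp.eval, hc5.one, mul_one,
    hx3]
  rw [hX2t] at hX2t'
  refine ⟨by omega, ?_⟩
  have hc6 := hc5.update (d := out) (x := outcome M inn E.n E.s E.t X a q d)
    (by rcases hout with rfl | rfl <;> decide)
  have ha_ne : Rg.a ≠ out := by rcases hout with rfl | rfl <;> decide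
  have hq_ne : Rg.q ≠ out := by rcases hout with rfl | rfl <;> decide
  refine wp.conseq (sweep_spec h hnm hm true hc6 hX2lt htp3
    (by simpa [ha_ne, k1] using ha)) ?_
  rintro τ4 ⟨htp4, hp4, hcl4⟩ fr4
  have hc7 : Consts E ℓ K M Q τ4.regs :=
    hc6.of_frame (σ := ⟨_, σ.tape, σ.pos, 0⟩) fr4 (by decide)
  have k3 := fr4 out (by rcases hout with rfl | rfl <;> rfl)
  simp only [ne_eq, ha_ne, hq_ne, not_false_eq_true, Function.update_of_ne, k1, k2,
    Function.update_self] at htp4 hp4 hcl4 k3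
  rw [hX2, sweep_cancel h a q hX1lt] at htp4
  simp only [wp_seq, wp_op, Op.Safe, Op.run, State.set,
    ArithOp.eval, Function.update_self, Function.update_of_ne, ne_eq, reduceCtorEq,
    not_false_eq_true, hc7.M, hc7.s, hc7.one, mul_one]
  refine ⟨by omega, by omega, by omega, ?_⟩
  have hc8 := ((hc7.update (d := .f) (x := d) (by decide)).update (d := .f) (x := M - d)
    (by decide)).update (d := .ad) (x := E.s) (by decide)
  refine wp.conseq (addEntry_spec h hc8 hX1lt htp4 (by simpa using hs) (by simp)) ?_
  rintro τ5 ⟨htp5, hp5, hcl5⟩ fr5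
  have k4 := fr5 out (by rcases hout with rfl | rfl <;> rfl)
  have hf_ne : out ≠ Rg.f := by rcases hout with rfl | rfl <;> decide
  have had_ne : out ≠ Rg.ad := by rcases hout with rfl | rfl <;> decide
  simp only [ne_eq, reduceCtorEq, not_false_eq_true, Function.update_of_ne, Function.update_self,
    hf_ne, had_ne] at htp5 hp5 hcl5 k4
  refine ⟨k4.trans k3, ?_, by omega, by omega⟩
  rw [htp5]
  congr 1
  rw [hX1, Function.update_idem, Function.update_eq_self_iff, Function.update_self,
    Nat.mod_add_mod, show X E.s + d + (M - d) = X E.s + M by omega, Nat.add_mod_right,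
    Nat.mod_eq_of_lt (hX _)]

theorem sample_spec (h : Setup E inn ℓ K M Q) {σ : State Rg} (hc : Consts E ℓ K M Q σ.regs) :
    wp E sample (fun τ => τ.regs .q = seedAt E.coins σ.pos (24 * ℓ) % Q ∧
      τ.regs .a = seedAt E.coins σ.pos (24 * ℓ) / Q ∧ τ.tape = σ.tape ∧
      τ.pos = σ.pos + 24 * ℓ ∧ τ.clock ≤ σ.clock + 8 * K) σ := by
  obtain ⟨b1, b2, b3, b4, b5, b6, b7, b8, b9⟩ := h.sizes
  have hℓ := h.one_le_ell
  have hK := h.K_eq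
  have hM := h.M_pos
  simp only [sample, const, copy, arith, wp_seq, wp_op, Op.Safe, Op.run, State.set, ArithOp.eval,
    Function.update_of_ne, ne_eq, reduceCtorEq, not_false_eq_true, hc.len, hc.one, mul_one]
  refine ⟨by omega, by omega, ?_⟩
  have hc1 := (hc.update (d := .z) (x := 0) (by decide)).update (d := .scount) (x := 24 * ℓ)
    (by decide)
  refine (wp_rep (fun i r tp p => r .z = seedAt E.coins σ.pos (24 * ℓ - i) ∧ tp = σ.tape ∧
    p = σ.pos + (24 * ℓ - i)) (fun _ => 3) ?_ ?_).conseq ?_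
  · simp [seedAt]
  · rintro i τ hi ⟨hz, htp, hp⟩ fr
    simp only [Function.update_self] at hi
    have hc2 : Consts E ℓ K M Q τ.regs :=
      hc1.of_frame (σ := ⟨_, σ.tape, σ.pos, 0⟩) fr (by decide)
    set j := 24 * ℓ - (i + 1) with hj
    have hj' : 24 * ℓ - i = j + 1 := by omega
    have hlt := seedAt_lt E.coins σ.pos j
    have hle : 2 ^ j ≤ 2 ^ (24 * ℓ) := Nat.pow_le_pow_right (by norm_num) (by omega)
    have hbit := (E.coins (σ.pos + j)).toNat_le
    simp only [wp_seq, wp_op, Op.Safe, Op.run, State.set, ArithOp.eval, Function.update_self,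
      Function.update_of_ne, ne_eq, reduceCtorEq, not_false_eq_true, hz, hp, hj', hc2.two, seedAt]
    refine ⟨trivial, by omega, by omega, ⟨by ring, htp, by omega⟩, by omega⟩
  · rintro τ ⟨⟨hz, htp, hp⟩, hcl⟩ fr
    have hc2 : Consts E ℓ K M Q τ.regs :=
      hc1.of_frame (σ := ⟨_, σ.tape, σ.pos, 0⟩) fr (by decide)
    simp only [Function.update_self, Finset.sum_const, Finset.card_range, smul_eq_mul] at hcl
    rw [Nat.sub_zero] at hz hp
    have hlt := seedAt_lt E.coins σ.pos (24 * ℓ)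
    have hdiv := Nat.div_le_self (seedAt E.coins σ.pos (24 * ℓ)) Q
    have hmod := Nat.mod_le (seedAt E.coins σ.pos (24 * ℓ)) Q
    simp only [wp_seq, wp_op, Op.Safe, Op.run, State.set, ArithOp.eval, Function.update_self,
      Function.update_of_ne, ne_eq, reduceCtorEq, not_false_eq_true, hz, hc2.Q]
    exact ⟨by omega, by omega, trivial, trivial, htp, hp, by omega⟩

/-- The seed `z` does not detect a path. -/
def Fails (E : Env) (inn : ℕ → List ℕ) (M Q : ℕ) (X : ℕ → ℕ) (z : ℕ) : Prop :=
  outcome M inn E.n E.s E.t X (z / Q) (z % Q) 0 = outcome M inn E.n E.s E.t X (z / Q) (z % Q) 1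

theorem trial_spec (h : Setup E inn ℓ K M Q) {m : ℕ} (hnm : E.n ≤ m)
    (hm : ∑ v ∈ Finset.range E.n, (inn v).length ≤ m) {σ : State Rg}
    (hc : Consts E ℓ K M Q σ.regs) {X : ℕ → ℕ} (hX : ∀ v, X v < M) (htape : σ.tape = enc K X)
    (hfound : σ.regs .found ≤ 4 * (M * M)) :
    wp E trial (fun τ => τ.regs .found ≤ σ.regs .found + M ∧
      (τ.regs .found = 0 ↔ σ.regs .found = 0 ∧
        Fails E inn M Q X (seedAt E.coins σ.pos (24 * ℓ))) ∧
      τ.tape = enc K X ∧ τ.pos = σ.pos + 24 * ℓ ∧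
      τ.clock ≤ σ.clock + 212 * (K * (E.n * m))) σ := by
  obtain ⟨b1, b2, b3, b4, b5, b6, b7, b8, b9⟩ := h.sizes
  have hs := h.s_lt
  have hnm1 : 1 ≤ E.n * m := Nat.mul_pos (by omega) (by omega)
  have hKnm : K * 1 ≤ K * (E.n * m) := Nat.mul_le_mul_left _ hnm1
  unfold Fails
  set z := seedAt E.coins σ.pos (24 * ℓ) with hz
  have hzlt : z < 2 ^ (24 * ℓ) := seedAt_lt _ _ _
  have hdiv := Nat.div_le_self z Q
  rw [trial, wp_seq]
  refine wp.conseq (sample_spec h hc) ?_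
  rintro τ1 ⟨hq, ha, htp1, hp1, hcl1⟩ fr1
  rw [← hz] at hq ha
  have hc1 := hc.of_frame fr1 (by decide)
  have f1 := fr1 .found rfl
  rw [wp_seq]
  refine wp.conseq (experiment_spec h hnm hm (d := 0) (by omega) (Or.inl rfl) hc1 hX
    (htp1.trans htape) (by omega)) ?_
  rintro τ2 ⟨hy0, htp2, hp2, hcl2⟩ fr2
  have hc2 := hc1.of_frame fr2 (by decide)
  have f2 := (fr2 .found rfl).trans f1
  have hq2 := (fr2 .q rfl).trans hq
  have ha2 := (fr2 .a rfl).trans ha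
  rw [wp_seq]
  refine wp.conseq (experiment_spec h hnm hm (d := 1) le_rfl (Or.inr rfl) hc2 hX htp2
    (by omega)) ?_
  rintro τ3 ⟨hy1, htp3, hp3, hcl3⟩ fr3
  have f3 := (fr3 .found rfl).trans f2
  have hy0' := (fr3 .y0 rfl).trans hy0
  have l0 := outcome_lt h.M_pos inn E.n E.s E.t hX (z / Q) (z % Q) 0
  have l1 := outcome_lt h.M_pos inn E.n E.s E.t hX (z / Q) (z % Q) 1
  rw [hq, ha] at hy0'
  rw [hq2, ha2] at hy1
  simp only [arith, wp_seq, wp_op, Op.Safe, Op.run, State.set, ArithOp.eval, Function.update_self,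
    Function.update_of_ne, ne_eq, reduceCtorEq, not_false_eq_true, hy0', hy1, f3]
  refine ⟨by omega, by omega, by omega, by omega, by omega, by omega, htp3, by omega, by omega⟩

theorem setup_spec (h : Setup E inn ℓ K M Q) {σ : State Rg} :
    wp E setup (fun τ => Consts E ℓ K M Q τ.regs ∧ τ.regs .trials = 64 * ℓ ∧ τ.tape = σ.tape ∧
      τ.pos = σ.pos ∧ τ.clock ≤ σ.clock + 27 * E.n) σ := by
  obtain ⟨b1, b2, b3, b4, b5, b6, b7, b8, b9⟩ := h.sizes
  have hℓ := h.one_le_ell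
  have hK := h.K_eq
  have hs := h.s_lt
  have ht := h.t_lt
  have hn := h.n_lt
  have hn' := h.le_n
  simp only [setup, const, copy, arith, wp_seq, wp_op, Op.Safe, Op.run, State.set, ArithOp.eval,
    Function.update_of_ne, Function.update_self, ne_eq, reduceCtorEq, not_false_eq_true, mul_one]
  refine ⟨by omega, by omega, by omega, by omega, by omega, by omega, by omega, by omega, ?_⟩
  refine (wp_rep (fun i r tp p => r .pw = 2 ^ r .ell ∧ r .ell ≤ ℓ ∧
    (r .ell = E.n - i ∨ E.n < 2 ^ r .ell) ∧ tp = σ.tape ∧ p = σ.pos) (fun _ => 5) ?_ ?_).conseq ?_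
  · simp
  · rintro i τ hi ⟨hpw, hle, hor, htp, hp⟩ fr
    have f1 := fr .one rfl
    have f2 := fr .nN rfl
    simp only [ne_eq, reduceCtorEq, not_false_eq_true, Function.update_of_ne,
      Function.update_self] at f1 f2 hi
    have hpwle : 2 ^ τ.regs .ell ≤ 2 ^ ℓ := Nat.pow_le_pow_right (by norm_num) hle
    simp only [wp_seq, wp_op, Op.Safe, Op.run, State.set, ArithOp.eval, Function.update_self,
      Function.update_of_ne, ne_eq, reduceCtorEq, not_false_eq_true, f1, f2, hpw]
    rcases le_or_gt (2 ^ τ.regs .ell) E.n with hc | hc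
    · have h0 : 2 ^ τ.regs .ell - E.n = 0 := by omega
      have hlt : τ.regs .ell < ℓ :=
        (Nat.pow_lt_pow_iff_right (by norm_num : 1 < 2)).1 (lt_of_le_of_lt hc hn)
      rw [h0]
      refine ⟨by omega, by omega, by omega, by omega, by omega, ⟨?_, by omega, ?_, htp, hp⟩,
        by omega⟩
      · simp [pow_succ]
      · left
        omega
    · have h0 : 1 - (2 ^ τ.regs .ell - E.n) = 0 := by omega
      rw [h0]
      refine ⟨by omega, by omega, by omega, by omega, by omega, ⟨?_, by omega, ?_, htp, hp⟩,
        by omega⟩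
      · simp
      · right
        simpa using hc
  · rintro τ ⟨⟨hpw, hle, hor, htp, hp⟩, hcl⟩ fr
    have hell : τ.regs .ell = ℓ := by
      -- If doubling never stopped, the exponent is `n` itself, and `n < 2 ^ n`.
      have h1 : E.n < 2 ^ τ.regs .ell := by
        rcases hor with h1 | h1
        · rw [h1, Nat.sub_zero]
          exact Nat.lt_two_pow_self
        · exact h1
      have h2 : 2 ^ ℓ < 2 ^ (τ.regs .ell + 1) := by rw [pow_succ]; omega
      have := (Nat.pow_lt_pow_iff_right (by norm_num : 1 < 2)).1 h2
      omega
    have f1 := fr .one rfl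
    have f2 := fr .nN rfl
    have f3 := fr .two rfl
    have f4 := fr .s rfl
    have f5 := fr .t rfl
    simp only [ne_eq, reduceCtorEq, not_false_eq_true, Function.update_of_ne,
      Function.update_self, Finset.sum_const, Finset.card_range, smul_eq_mul] at f1 f2 f3 f4 f5 hcl
    have e2 : 2 ^ ℓ * 2 ^ ℓ = 2 ^ (2 * ℓ) := by rw [← pow_add]; ring_nf
    have e4 : 2 ^ (2 * ℓ) * 2 ^ (2 * ℓ) = 2 ^ (4 * ℓ) := by rw [← pow_add]; ring_nf
    have e8 : 2 ^ (4 * ℓ) * 2 ^ (4 * ℓ) = Q := by rw [h.Q_eq, ← pow_add]; ring_nf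
    have e16 : Q * Q = M := by rw [h.Q_eq, h.M_eq, hK, ← pow_add]; ring_nf
    have l2 : 2 ^ (2 * ℓ) ≤ Q := by
      rw [h.Q_eq]; exact Nat.pow_le_pow_right (by norm_num) (by omega)
    have l4 : 2 ^ (4 * ℓ) ≤ Q := by
      rw [h.Q_eq]; exact Nat.pow_le_pow_right (by norm_num) (by omega)
    have hK' := hK.symm
    rw [hell] at hpw
    simp only [wp_seq, wp_op, Op.Safe, Op.run, State.set, ArithOp.eval, Function.update_self,
      Function.update_of_ne, ne_eq, reduceCtorEq, not_false_eq_true, hell, hpw, e2, e4, e8, e16,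
      hK']
    refine ⟨by omega, by omega, by omega, by omega, by omega, by omega, by omega, by omega,
      by omega, by omega, ⟨?_, ?_, ?_, ?_, ?_, ?_, ?_, ?_, ?_⟩, trivial, htp, hp, by omega⟩
    all_goals simp [f1, f2, f3, f4, f5]

theorem reachability_spec (h : Setup E inn ℓ K M Q) {m : ℕ} (hnm : E.n ≤ m)
    (hm : ∑ v ∈ Finset.range E.n, (inn v).length ≤ m)
    {X : ℕ → ℕ} (hX : ∀ v, X v < M) :
    wp E reachability (fun τ => (τ.tape = enc K X ∧ (τ.regs .found = 0 ↔
        ∀ j < 64 * ℓ, Fails E inn M Q X (seedAt E.coins (j * (24 * ℓ)) (24 * ℓ)))) ∧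
      τ.clock + 2 ≤ 1000 * (K * (K * (E.n * m)))) ⟨fun _ => 0, enc K X, 0, 0⟩ := by
  obtain ⟨b1, b2, b3, b4, b5, b6, b7, b8, b9⟩ := h.sizes
  have hK := h.K_eq
  rw [reachability, wp_seq]
  refine wp.conseq (setup_spec h) ?_
  rintro τ ⟨hc, htr, htp, hp, hcl⟩ fr
  have f1 := fr .found rfl
  refine (wp_rep (fun i r tp p => r .found ≤ (64 * ℓ - i) * M ∧ tp = enc K X ∧
    p = (64 * ℓ - i) * (24 * ℓ) ∧ (r .found = 0 ↔ ∀ j < 64 * ℓ - i,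
      Fails E inn M Q X (seedAt E.coins (j * (24 * ℓ)) (24 * ℓ))))
    (fun _ => 212 * (K * (E.n * m))) ?_ ?_).conseq ?_
  · simp [htr, f1, htp, hp]
  · rintro i τ1 hi ⟨hf, htp1, hp1, hiff⟩ fr1
    rw [htr] at hi
    set k := 64 * ℓ - (i + 1) with hk
    have hk' : 64 * ℓ - i = k + 1 := by omega
    have hkM : k * M ≤ 4 * K * M := Nat.mul_le_mul_right _ (by omega)
    have hkM' : 4 * K * M = 4 * (K * M) := by ring
    have hc1 := hc.of_frame fr1 (by decide)
    refine wp.conseq (trial_spec h hnm hm (σ := τ1.set .trials i 2) (hc1.update (by decide)) hX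
      htp1 (by simp [State.set]; omega)) ?_
    rintro τ2 ⟨hf2, hiff2, htp2, hp2, hcl2⟩ _
    simp only [State.set, Function.update_of_ne, ne_eq, reduceCtorEq, not_false_eq_true]
      at hf2 hiff2 hp2 hcl2
    rw [hk']
    refine ⟨⟨by rw [add_mul]; omega, htp2, by rw [hp2, hp1]; ring, ?_⟩, by omega⟩
    rw [hiff2, hiff, hp1, Nat.forall_lt_succ_right]
  · rintro τ1 ⟨⟨-, htp1, -, hiff⟩, hcl1⟩ _
    rw [Nat.sub_zero] at hiff
    refine ⟨⟨htp1, hiff⟩, ?_⟩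
    simp only [htr, Finset.sum_const, Finset.card_range, smul_eq_mul] at hcl1
    have hs := h.s_lt
    -- The number of trials is `4 * K`, whence the second factor `K` and `848 = 4 * 212`.
    have h1 : 64 * ℓ * (212 * (K * (E.n * m)) + 2) = 848 * (K * (K * (E.n * m))) + 8 * K := by
      rw [show 64 * ℓ = 4 * K by omega]; ring
    have hm1 : E.n * 1 ≤ E.n * m := Nat.mul_le_mul_left _ (by omega)
    have h2 : K * 1 ≤ K * (E.n * m) := Nat.mul_le_mul_left _ (by omega)
    have h3 : 16 * (E.n * m) ≤ K * (E.n * m) := Nat.mul_le_mul_right _ b1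
    have h4 : 16 * (K * (E.n * m)) ≤ K * (K * (E.n * m)) := Nat.mul_le_mul_right _ b1
    simp only at hcl
    omega

end Specs

/-! ### The main theorem -/

/-- The in-neighbours of a vertex, as numbers. -/
def GraphOracle.inn {n : ℕ} {G : Digraph (Fin n)} (O : GraphOracle G) (v : ℕ) : List ℕ :=
  (listAt O.inList v).map Fin.val

/-! ### In-neighbour lists of a graph oracle -/

section Oracle

variable {n : ℕ} {G : Digraph (Fin n)} (O : GraphOracle G)

theorem GraphOracle.inn_val (v : Fin n) : O.inn v = (O.inList v).map Fin.val := by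
  simp [GraphOracle.inn, listAt]

theorem GraphOracle.mem_inn {u v : ℕ} :
    u ∈ O.inn v ↔ ∃ (hu : u < n) (hv : v < n), G.Adj ⟨u, hu⟩ ⟨v, hv⟩ := by
  unfold GraphOracle.inn listAt
  split_ifs with hv
  · simp only [List.mem_map, O.mem_inList]
    constructor
    · rintro ⟨w, hw, rfl⟩
      exact ⟨w.2, hv, hw⟩
    · rintro ⟨hu, _, h⟩
      exact ⟨_, h, rfl⟩
  · simp [hv]

theorem GraphOracle.length_inn_le (v : ℕ) : (O.inn v).length ≤ n := by
  unfold GraphOracle.inn listAt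
  split_ifs with hv
  · simpa using (O.inList_nodup ⟨v, hv⟩).length_le_card
  · simp

theorem GraphOracle.reachable_iff (s t : Fin n) :
    Relation.ReflTransGen (fun u v => u ∈ O.inn v) s t ↔ Relation.ReflTransGen G.Adj s t := by
  constructor
  · have key : ∀ t : ℕ, Relation.ReflTransGen (fun u v => u ∈ O.inn v) s t →
        ∃ h : t < n, Relation.ReflTransGen G.Adj s ⟨t, h⟩ := by
      intro t ht
      induction ht with
      | refl => exact ⟨s.2, .refl⟩
      | tail _ huv ih =>
        obtain ⟨hu, hv, h⟩ := O.mem_inn.1 huv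
        exact ⟨hv, ih.2.tail h⟩
    intro h
    exact (key t h).2
  · exact fun h => h.lift Fin.val fun u v huv => O.mem_inn.2 ⟨u.2, v.2, huv⟩

/-- Every edge is counted once, at its head. This bounds the cost of a round in terms of `m`. -/
theorem GraphOracle.sum_length_inn :
    ∑ v ∈ Finset.range n, (O.inn v).length = numEdges G := by
  classical
  rw [Finset.sum_range, numEdges]
  have h1 : ∀ v : Fin n, (O.inn v).length = (O.inList v).toFinset.card := by
    intro v
    rw [O.inn_val, List.length_map, List.toFinset_card_of_nodup (O.inList_nodup v)]
  rw [Finset.sum_congr rfl fun v _ => h1 v, ← Finset.card_sigma, ← Set.ncard_coe_finset]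
  refine Set.ncard_congr (fun p _ => (p.2, p.1)) ?_ ?_ ?_
  · rintro ⟨v, u⟩ h
    simpa [O.mem_inList] using h
  · rintro ⟨v, u⟩ ⟨v', u'⟩ _ _ h
    simp only [Prod.mk.injEq] at h
    rw [h.1, h.2]
  · rintro ⟨u, v⟩ h
    exact ⟨⟨v, u⟩, by simpa [O.mem_inList] using h, rfl⟩

theorem GraphOracle.setup_env (hloop : ∀ v, ¬ G.Adj v v) (s t : Fin n) (coins : ℕ → Bool) :
    Setup (O.env s t coins (n * (16 * n.size)) (2 ^ (40 * n.size))) O.inn n.size (16 * n.size)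
      (2 ^ (16 * n.size)) (2 ^ (8 * n.size)) where
  deg v _ := by simp [GraphOracle.env, degQuery, GraphOracle.inn]
  nbr v _ i h := by
    have h' : i < (listAt O.inList v).length := by simpa [GraphOracle.inn] using h
    simp [GraphOracle.env, nbrQuery, GraphOracle.inn, List.getElem?_eq_getElem h']
  inn_lt u v h := (O.mem_inn.1 h).1
  not_mem v h := by
    obtain ⟨_, _, h⟩ := O.mem_inn.1 h
    exact hloop _ h
  length_le := O.length_inn_le
  s_lt := s.2
  t_lt := t.2
  n_lt := Nat.lt_size_self n
  le_n := by
    have hn : 0 < n := s.pos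
    have h1 : 0 < n.size := Nat.size_pos.2 hn
    have h2 : 2 ^ (n.size - 1) ≤ n := Nat.lt_size.1 (by omega)
    have h3 : 2 ^ n.size = 2 * 2 ^ (n.size - 1) := by
      rw [← pow_succ', Nat.sub_add_cancel h1]
    change 2 ^ n.size ≤ 2 * n
    omega
  K_eq := rfl
  M_eq := rfl
  Q_eq := rfl
  W_eq := rfl
  B_eq := rfl

end Oracle

/-! ### Decoding the initial tape, and conclusion -/

/-- The entries stored on a tape. -/
def decode {n K : ℕ} (τ : Fin (n * K) → Bool) (v : ℕ) : ℕ :=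
  Nat.ofBits fun j : Fin K => if h : v * K + j < n * K then τ ⟨v * K + j, h⟩ else false

theorem decode_lt {n K : ℕ} (τ : Fin (n * K) → Bool) (v : ℕ) : decode τ v < 2 ^ K :=
  Nat.ofBits_lt_two_pow _

/-- Needed for `card_good_shifts`, where the entries are indexed by all natural numbers. -/
theorem decode_eq_zero {n K : ℕ} (τ : Fin (n * K) → Bool) (v : ℕ) (hv : n ≤ v) :
    decode τ v = 0 := by
  refine Nat.eq_of_testBit_eq fun i => ?_
  have : ∀ j : Fin K, ¬ v * K + j < n * K := fun j => by
    have := Nat.mul_le_mul_right K hv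
    omega
  rw [decode, Nat.testBit_ofBits]
  rw [Nat.zero_testBit]
  split_ifs with h1 h2
  · exact absurd h2 (this ⟨i, h1⟩)
  · rfl
  · rfl

/-- Every tape encodes some entries, so specifications for arbitrary entries cover arbitrary initial
contents. -/
theorem enc_decode {n K : ℕ} (τ : Fin (n * K) → Bool) (i : Fin (n * K)) :
    enc K (decode τ) i = τ i := by
  have hK : 0 < K := Nat.pos_of_ne_zero fun h => by
    have := i.2
    simp [h] at this
  rw [enc, decode, Nat.testBit_ofBits_lt _ _ (Nat.mod_lt _ hK)]
  simp [Nat.div_add_mod']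

theorem size_le_log {n : ℕ} (hn : 2 ≤ n) : n.size ≤ 2 * Nat.log 2 n := by
  have h1 : n.size ≤ Nat.log 2 n + 1 := Nat.size_le.2 (Nat.lt_pow_succ_log_self (by norm_num) n)
  have h2 : 1 ≤ Nat.log 2 n := Nat.log_pos (by norm_num) hn
  omega

end CatRAM

theorem theorem2 :
    ∃ (M : CatRAM.Machine) (S W : ℕ → ℕ) (T : ℕ → ℕ → ℕ),
      -- the workspace is `O(log n)`
      (∃ C : ℕ, ∀ n, 2 ≤ n → S n ≤ C * Nat.log 2 n) ∧
      -- the catalytic space is `Õ(n)`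
      (∃ C k : ℕ, ∀ n, 2 ≤ n → W n ≤ C * n * Nat.log 2 n ^ k) ∧
      -- the running time is `Õ(n m)`
      (∃ C k : ℕ, ∀ n m, 2 ≤ n → n ≤ m → T n m ≤ C * (n * m) * Nat.log 2 n ^ k) ∧
      ∀ (n m : ℕ) (G : Digraph (Fin n)),
        (∀ v, ¬ G.Adj v v) → CatRAM.numEdges G = m → n ≤ m →
        ∀ (O : CatRAM.GraphOracle G) (s t : Fin n) (τ : Fin (W n) → Bool),
          -- for all outcomes of the coin tosses, the machine halts within `T n m` steps, with the
          -- catalytic tape restored, never uses more than `S n` bits of workspace, and answers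
          -- yes only if there is a path
          (∀ coins : ℕ → Bool,
            (M.run O s t coins τ (T n m)).answer ≠ none ∧
            (M.run O s t coins τ (T n m)).tape = τ ∧
            (∀ k, (M.run O s t coins τ k).workspace ≤ S n) ∧
            ((M.run O s t coins τ (T n m)).answer = some true →
              Relation.ReflTransGen G.Adj s t)) ∧
          -- if there is a path, the answer is yes with probability at least `1/2`
          (Relation.ReflTransGen G.Adj s t →
            1 / 2 ≤ CatRAM.coinMeasure
              {coins | (M.run O s t coins τ (T n m)).answer = some true}) := by
  open CatRAM in
  refine ⟨reachability.machine .found, fun n => Fintype.card (Option Rg) * (40 * n.size),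
    fun n => n * (16 * n.size), fun n m => 1000 * (16 * n.size * (16 * n.size * (n * m))),
    ⟨Fintype.card (Option Rg) * 80, fun n hn => ?_⟩, ⟨32, 1, fun n hn => ?_⟩,
    ⟨1000 * (32 * 32), 2, fun n m hn _ => ?_⟩, ?_⟩
  · have := size_le_log hn
    calc Fintype.card (Option Rg) * (40 * n.size)
        ≤ Fintype.card (Option Rg) * (40 * (2 * Nat.log 2 n)) := by gcongr
      _ = _ := by ring
  · have := size_le_log hn
    calc n * (16 * n.size) ≤ n * (16 * (2 * Nat.log 2 n)) := by gcongr
      _ = _ := by ring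
  · have := size_le_log hn
    calc 1000 * (16 * n.size * (16 * n.size * (n * m)))
        ≤ 1000 * (16 * (2 * Nat.log 2 n) * (16 * (2 * Nat.log 2 n) * (n * m))) := by gcongr
      _ = _ := by ring
  intro n m G hloop hnum hnm O s t τ
  have hn : 1 ≤ n := s.pos
  have hτ : τ = fun i : Fin (n * (16 * n.size)) => enc (16 * n.size) (decode τ) i :=
    funext fun i => (enc_decode τ i).symm
  have hℓ : 1 ≤ n.size := Nat.size_pos.2 hn
  have hB : 1 < 2 ^ (40 * n.size) := Nat.one_lt_two_pow (by omega)
  -- The answer is no iff all seeds are bad. Without a path every seed is bad; with a path a single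
  -- good seed suffices for yes.
  have main : ∀ coins : ℕ → Bool,
      let run := (reachability.machine Rg.found).run O s t coins τ
      let T := 1000 * (16 * n.size * (16 * n.size * (n * m)))
      (∀ k, (run k).Below (2 ^ (40 * n.size))) ∧ (run T).tape = τ ∧
      ∃ b, (run T).answer = some b ∧ (b = false ↔ ∀ j < 64 * n.size,
        seedAt coins (j * (24 * n.size)) (24 * n.size) ∈
          badSeeds n.size O.inn n s t (decode τ)) := by
    intro coins
    have h := O.setup_env hloop s t coins
    obtain ⟨σ, ⟨htape, hfound⟩, hbelow, htape', hans⟩ := machine_run O s t coins hB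
      (p₀ := reachability) (out := Rg.found) (by decide) _ _ _
      (reachability_spec h hnm (O.sum_length_inn.trans hnum).le (decode_lt τ))
    rw [← hτ] at hbelow htape' hans
    refine ⟨hbelow, ?_, _, hans, ?_⟩
    · exact htape'.trans (htape ▸ hτ.symm)
    · rw [decide_eq_false_iff_not, not_not, hfound]
      refine forall₂_congr fun j _ => ?_
      simp only [badSeeds, Finset.mem_filter, Finset.mem_range, seedAt_lt, true_and]
      rfl
  refine ⟨fun coins => ?_, fun hpath => ?_⟩
  · obtain ⟨h1, h2, b, h3, h4⟩ := main coins
    refine ⟨by rw [h3]; simp, h2, fun k => ?_, fun h => ?_⟩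
    · calc _ ≤ ∑ _r : Option Rg, 40 * n.size :=
            Finset.sum_le_sum fun r _ => Nat.size_le.2 (h1 k r)
        _ = _ := by rw [Finset.sum_const, Finset.card_univ, smul_eq_mul]
    · by_contra hno
      rw [h3, Option.some_inj] at h
      rw [← O.reachable_iff] at hno
      refine absurd (h4.2 fun j _ => ?_) (by simp [h])
      simp only [badSeeds, Finset.mem_filter, Finset.mem_range, seedAt_lt, true_and]
      exact outcome_eq _ _ _ _ _ hno
  · have hcard := card_badSeeds (x := decode τ) hn (Nat.lt_size_self n) O.length_inn_le
      (fun u v h => (O.mem_inn.1 h).2.1) s.2 (decode_eq_zero τ) ((O.reachable_iff s t).2 hpath)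
    refine one_half_le_coinMeasure (by omega) hcard ?_
    rintro coins ⟨j, hj, hjF⟩
    obtain ⟨-, -, b, h3, h4⟩ := main coins
    change _ = _
    rw [h3]
    cases b
    · exact absurd (h4.1 rfl j hj) hjF
    · rfl
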